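/- Let $\Omega$ be a finite set, $P$ an irreducible transition matrix on $\Omega$, reversible with respect to its stationary distribution $\pi$, i.e. $\pi(x)P(x,y)=\pi(y)P(y,x)$ for all $x,y$. Let $(X_t)_{t\in\mathbb{Z}_{\ge 0}}$ be the discrete-time chain with transition matrix $P$, and let $(X^{\mathrm{ct}}_t)_{t\ge 0}$ be its continuous-time version, which follows the discrete chain with i.i.d. rate-$1$ exponential holding times and has heat kernel $H_t=\sum_{k\ge 0}\frac{e^{-t}t^k}{k!}P^k$. The chain is lazy if $P(x,x)\ge 1/2$ for all $x$. Write $\|\cdot\|_{\mathrm{TV}}$ for total variation distance and set $$d(t)=\max_{x}\|P^t(x,\cdot)-\pi\|_{\mathrm{TV}},\qquad t_{\mathrm{mix}}(\epsilon)=\inf\{t: d(t)\le\epsilon\},$$ $$p(\alpha,t)=\max_{x\in\Omega}\ \max_{A\subset\Omega:\,\pi(A)\ge\alpha}\Pr_x[T_A>t],\qquad \mathrm{hit}_\alpha(\epsilon)=\min\{t: p(\alpha,t)\le\epsilon\},$$ where $T_A=\inf\{t\ge 0: X_t\in A\}$; let $t^{\mathrm{ct}}_{\mathrm{mix}}$ and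 $\mathrm{hit}^{\mathrm{ct}}_\alpha$ be defined in the same way from $H_t$ and $X^{\mathrm{ct}}$, with real times $t\ge 0$. Let $\lambda_2<1$ be the second largest eigenvalue of $P$ and $t_{\mathrm{rel}}=(1-\lambda_2)^{-1}$ (with $t_{\mathrm{rel}}=1$ if $|\Omega|=1$). Let $\epsilon\in(0,\frac14]$. (1) If the chain is lazy, then $$\mathrm{hit}_{1/2}(3\epsilon/2)-\lceil 2t_{\mathrm{rel}}|\log\epsilon|\rceil\le t_{\mathrm{mix}}(\epsilon)\le \mathrm{hit}_{1/2}(\epsilon/2)+\lceil t_{\mathrm{rel}}\log(4/\epsilon)\rceil,$$ $$\mathrm{hit}_{1/2}(1-\epsilon/2)-\lceil 2t_{\mathrm{rel}}|\log\epsilon|\rceil\le t_{\mathrm{mix}}(1-\epsilon)\le \mathrm{hit}_{1/2}(1-2\epsilon)+\lceil t_{\mathrm{rel}}\rceil,$$ $$\max\{\mathrm{hit}_{1-\epsilon/4}(5\epsilon/4),\,(t_{\mathrm{rel}}-1)|\log 2\epsilon|\}\le t_{\mathrm{mix}}(\epsilon)\le \mathrm{hit}_{1-\epsilon/4}(3\epsilon/4)+\left\lceil\tfrac{3t_{\mathrm{rel}}}{2}\log(4/\epsilon)\right\rceil.$$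 (2) In continuous time (whether or not the chain is lazy) all of these inequalities hold with $t_{\mathrm{mix}}$ and $\mathrm{hit}$ replaced by $t^{\mathrm{ct}}_{\mathrm{mix}}$ and $\mathrm{hit}^{\mathrm{ct}}$, and with all ceiling signs omitted. -/

import Mathlib

open MeasureTheory ProbabilityTheory
open scoped NNReal ENNReal

noncomputable section

namespace FiniteChain

variable {Ω : Type*} [Fintype Ω] [DecidableEq Ω]

/-- `π` is a stationary probability distribution of the transition matrix `P`. -/
def IsStationary (P : Matrix.rowStochastic ℝ Ω) (π : Ω → ℝ) : Prop :=
  π ∈ stdSimplex ℝ Ω ∧ Matrix.vecMul π P.1 = π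

/-- Reversibility (detailed balance). -/
def IsReversible (P : Matrix.rowStochastic ℝ Ω) (π : Ω → ℝ) : Prop :=
  ∀ x y, π x * P.1 x y = π y * P.1 y x

/-- Laziness: every holding probability is at least one half. -/
def IsLazy (P : Matrix.rowStochastic ℝ Ω) : Prop :=
  ∀ x, 1 / 2 ≤ P.1 x x

/-- The largest eigenvalue of `f ↦ P f` other than `1`. For an irreducible reversible chain all
eigenvalues are real and `1` is a simple eigenvalue, so that this is the second largest one,
`1 = λ₁ > λ₂ ≥ …`. On a one-point space there is no such eigenvalue and the value is `0`. -/
def secondEigenvalue (P : Matrix.rowStochastic ℝ Ω) : ℝ :=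
  sSup {l : ℝ | l ≠ 1 ∧ Module.End.HasEigenvalue (Matrix.toLin' P.1) l}

/-- The relaxation time `(1 - λ₂)⁻¹`. -/
def relTime (P : Matrix.rowStochastic ℝ Ω) : ℝ :=
  (1 - secondEigenvalue P)⁻¹

/-- Total variation distance of two distributions on a finite set. -/
def tvDist (μ ν : Ω → ℝ) : ℝ :=
  (1 / 2) * ∑ y, |μ y - ν y|

/-! ### Mixing times -/

/-- Worst-case distance from stationarity `d(t)`, discrete time: `Pₓ(X_t = y) = P ^ t (x, y)`. -/
def dist (P : Matrix.rowStochastic ℝ Ω) (π : Ω → ℝ) (t : ℕ) : ℝ :=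
  ⨆ x : Ω, tvDist (fun y => (P.1 ^ t) x y) π

/-- The mixing time `t_mix(ε)`. -/
def tMix (P : Matrix.rowStochastic ℝ Ω) (π : Ω → ℝ) (ε : ℝ) : ℕ :=
  sInf {t : ℕ | dist P π t ≤ ε}

/-- The heat kernel of the continuous-time version of the chain. -/
def heatKernel (P : Matrix.rowStochastic ℝ Ω) (t : ℝ≥0) (x y : Ω) : ℝ :=
  ∑' k : ℕ, Real.exp (-(t : ℝ)) * (t : ℝ) ^ k / (k.factorial : ℝ) * (P.1 ^ k) x y

/-- Worst-case distance from stationarity, continuous time. -/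
def distCt (P : Matrix.rowStochastic ℝ Ω) (π : Ω → ℝ) (t : ℝ≥0) : ℝ :=
  ⨆ x : Ω, tvDist (fun y => heatKernel P t x y) π

/-- The mixing time of the continuous-time chain. -/
def tMixCt (P : Matrix.rowStochastic ℝ Ω) (π : Ω → ℝ) (ε : ℝ) : ℝ≥0 :=
  sInf {t : ℝ≥0 | distCt P π t ≤ ε}

/-! ### The laws of the chains -/

variable [MeasurableSpace Ω] [MeasurableSingletonClass Ω]

/-- The one-step transition kernel `x ↦ ∑ y, P(x, y) δ_y`. -/
def stepKernel (P : Matrix.rowStochastic ℝ Ω) : Kernel Ω Ω where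
  toFun x := ∑ y, ENNReal.ofReal (P.1 x y) • Measure.dirac y
  measurable' := Measurable.of_discrete

instance isMarkovKernel_stepKernel (P : Matrix.rowStochastic ℝ Ω) : IsMarkovKernel (stepKernel P) where
  isProbabilityMeasure x := by
    constructor
    change (∑ y, ENNReal.ofReal (P.1 x y) • Measure.dirac y : Measure Ω) Set.univ = 1
    rw [Measure.finsetSum_apply]
    simp only [Measure.smul_apply, measure_univ, smul_eq_mul, mul_one]
    rw [← ENNReal.ofReal_sum_of_nonneg fun y _ => P.2.1 x y,
      Matrix.sum_row_of_mem_rowStochastic P.2 x, ENNReal.ofReal_one]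

/-- The law `Pₓ` of the trajectory `(X_n)` started at `x`, as a measure on `ℕ → Ω`: the next
state is drawn from `stepKernel P` at the current state. -/
def chainLaw (P : Matrix.rowStochastic ℝ Ω) (x : Ω) : Measure (ℕ → Ω) :=
  Kernel.traj (X := fun _ => Ω)
    (fun n => (stepKernel P).comap
      (fun h : (∀ _ : Finset.Iic n, Ω) => h ⟨n, Finset.mem_Iic.2 le_rfl⟩)
      (measurable_pi_apply _))
    0 (fun _ => x)

/-- The number of jumps up to time `t` when the holding times are `τ 0, τ 1, …`. -/
def jumpCount (τ : ℕ → ℝ) (t : ℝ≥0) : ℕ :=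
  sSup {n : ℕ | ∑ i ∈ Finset.range n, τ i ≤ t}

/-- The law `Hₓ` of the data of the continuous-time chain started at `x`: the discrete chain
together with independent i.i.d. exponential holding times of rate `1`. -/
def chainLawCt (P : Matrix.rowStochastic ℝ Ω) (x : Ω) : Measure ((ℕ → Ω) × (ℕ → ℝ)) :=
  (chainLaw P x).prod (Measure.infinitePi fun _ : ℕ => expMeasure 1)

/-- The discrete-time chain. -/
def process (t : ℕ) (ω : ℕ → Ω) : Ω := ω t

/-- The continuous-time chain: it follows the discrete chain and jumps at the successive sums of
the holding times. -/
def processCt (t : ℝ≥0) (ω : (ℕ → Ω) × (ℕ → ℝ)) : Ω := ω.1 (jumpCount ω.2 t)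

/-! ### Hitting times of large sets

`hittingAfter X A 0` is the hitting time `T_A = inf {t ≥ 0 : X_t ∈ A}`, equal to `⊤` if `A` is
never visited. -/

/-- `p(α, t)`: the maximum over starting states `x` and sets `A` with `π(A) ≥ α` of
`Pₓ[T_A > t]`. -/
def hitTail (P : Matrix.rowStochastic ℝ Ω) (π : Ω → ℝ) (α : ℝ) (t : ℕ) : ℝ :=
  ⨆ x : Ω, ⨆ A : {A : Finset Ω // α ≤ ∑ y ∈ A, π y},
    (chainLaw P x).real {ω | (t : WithTop ℕ) < hittingAfter process (A.1 : Set Ω) 0 ω}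

/-- `hit_α(ε)`. -/
def hit (P : Matrix.rowStochastic ℝ Ω) (π : Ω → ℝ) (α ε : ℝ) : ℕ :=
  sInf {t : ℕ | hitTail P π α t ≤ ε}

/-- The continuous-time analogue of `hitTail`. -/
def hitTailCt (P : Matrix.rowStochastic ℝ Ω) (π : Ω → ℝ) (α : ℝ) (t : ℝ≥0) : ℝ :=
  ⨆ x : Ω, ⨆ A : {A : Finset Ω // α ≤ ∑ y ∈ A, π y},
    (chainLawCt P x).real {ω | (t : WithTop ℝ≥0) < hittingAfter processCt (A.1 : Set Ω) 0 ω}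

/-- `hit_α(ε)` for the continuous-time chain. -/
def hitCt (P : Matrix.rowStochastic ℝ Ω) (π : Ω → ℝ) (α ε : ℝ) : ℝ≥0 :=
  sInf {t : ℝ≥0 | hitTailCt P π α t ≤ ε}

end FiniteChain

end

noncomputable section

namespace FiniteChain

variable {Ω : Type*} [Fintype Ω]

/-! ### Weighted inner products and eigenbases -/

/-! Fix a set `A`, put `a = π(A)` and `f = 1_A - a`, and let `M` be the semigroup and `g` its
spectral gap. The gap gives `‖M_s f‖² ≤ e^{-2gs} a(1-a)` in `L²(π)`. A weak maximal inequality
(`EigenBasis.maximal`) then shows that the set `B` of points `y` with `|M_{r+s} 1_A(y) - a| > m` for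
some `r ≥ 0` satisfies `π(B) ≤ 4‖M_s f‖²/m²`. So the complement `G` of `B` is large, and from every
point of `G` the chain is in `A` with probability at least `a - m` at every time from `s` onwards.
By the strong Markov property at the hitting time of `G`, the probability of being in `A` at time `t
+ s` is at least `(a - m)(1 - Pₓ[T_G > t])`. This is `HittingSystem.exists_tail_of_hitLe`; the three
upper bounds on the mixing time are choices of `m` and `s` in it.

Conversely, a chain that has mixed up to `δ` at time `t` avoids `A` during `s` further units of time
with probability at most `δ` plus the stationary tail. The latter is at most `(1 - π(A)) e^{-π(A) g
s}`, because the eigenvalues of the chain killed on `A` that matter are at most `1 - π(A) g`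
(`EigenBasis.killed_ev_le`). The bound by the relaxation time tests the distance to stationarity
against an eigenfunction for `λ₂`.

All comparisons are made once, for an abstract `HittingSystem`, which both time scales satisfy
(`hittingSystem_nat`, `hittingSystem_nnreal`). Laziness serves only to make the eigenvalues of `P`
and of the killed chain nonnegative, so that `λ^n` is nonnegative and decreasing in `n`; in
continuous time `e^{-t(1-λ)}` has these properties for every `λ ≤ 1`. What remains is to identify
the laws of hitting times with powers of the killed matrix, or with Poisson mixtures of such powers.
-/

/-- The inner product of `L²(π)`. -/
def ip (π f g : Ω → ℝ) : ℝ := ∑ x, π x * f x * g x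

section ip

variable (π : Ω → ℝ)

theorem ip_comm (f g : Ω → ℝ) : ip π f g = ip π g f :=
  Finset.sum_congr rfl fun x _ => by ring

theorem ip_add_left (f g h : Ω → ℝ) : ip π (f + g) h = ip π f h + ip π g h := by
  simp only [ip, Pi.add_apply, ← Finset.sum_add_distrib]
  exact Finset.sum_congr rfl fun x _ => by ring

theorem ip_sub_left (f g h : Ω → ℝ) : ip π (f - g) h = ip π f h - ip π g h := by
  simp only [ip, Pi.sub_apply, ← Finset.sum_sub_distrib]
  exact Finset.sum_congr rfl fun x _ => by ring

theorem ip_smul_left (c : ℝ) (f h : Ω → ℝ) : ip π (c • f) h = c * ip π f h := by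
  simp only [ip, Pi.smul_apply, smul_eq_mul, Finset.mul_sum]
  exact Finset.sum_congr rfl fun x _ => by ring

theorem ip_smul_right (c : ℝ) (f h : Ω → ℝ) : ip π f (c • h) = c * ip π f h := by
  rw [ip_comm, ip_smul_left, ip_comm]

theorem ip_sum_left {ι : Type*} (s : Finset ι) (f : ι → Ω → ℝ) (h : Ω → ℝ) :
    ip π (∑ i ∈ s, f i) h = ∑ i ∈ s, ip π (f i) h := by
  simp only [ip, Finset.sum_apply, Finset.mul_sum, Finset.sum_mul]
  exact Finset.sum_comm

theorem ip_sum_right {ι : Type*} (s : Finset ι) (f : ι → Ω → ℝ) (h : Ω → ℝ) :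
    ip π h (∑ i ∈ s, f i) = ∑ i ∈ s, ip π h (f i) := by
  rw [ip_comm, ip_sum_left]
  exact Finset.sum_congr rfl fun i _ => ip_comm _ _ _

theorem ip_single_left [DecidableEq Ω] (y : Ω) (f : Ω → ℝ) : ip π (Pi.single y 1) f = π y * f y := by
  rw [ip, Finset.sum_eq_single y]
  · simp
  · intro b _ hb
    simp [Pi.single_eq_of_ne hb]
  · simp

variable {π}

theorem ip_self_nonneg (hπ : ∀ x, 0 ≤ π x) (f : Ω → ℝ) : 0 ≤ ip π f f :=
  Finset.sum_nonneg fun x _ => by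
    rw [mul_assoc]
    exact mul_nonneg (hπ x) (mul_self_nonneg _)

theorem ip_sq_le (hπ : ∀ x, 0 ≤ π x) (f g : Ω → ℝ) :
    ip π f g ^ 2 ≤ ip π f f * ip π g g := by
  have h := Finset.sum_mul_sq_le_sq_mul_sq Finset.univ (fun x => √(π x) * f x)
    (fun x => √(π x) * g x)
  have e : ∀ a b : Ω → ℝ, ∑ x, √(π x) * a x * (√(π x) * b x) = ip π a b := fun a b =>
    Finset.sum_congr rfl fun x _ => by
      rw [show √(π x) * a x * (√(π x) * b x) = (√(π x) * √(π x)) * a x * b x by ring,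
        Real.mul_self_sqrt (hπ x)]
  simp only [pow_two (√(π _) * _), e] at h
  exact h

theorem ip_mulVec_comm {K : Matrix Ω Ω ℝ} (hK : ∀ x y, π x * K x y = π y * K y x)
    (f g : Ω → ℝ) : ip π (K.mulVec f) g = ip π f (K.mulVec g) := by
  simp only [ip, Matrix.mulVec, dotProduct, Finset.mul_sum, Finset.sum_mul]
  rw [Finset.sum_comm]
  refine Finset.sum_congr rfl fun x _ => Finset.sum_congr rfl fun y _ => ?_
  rw [show π y * (K y x * f x) * g y = (π y * K y x) * f x * g y by ring, ← hK]
  ring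

end ip

variable [DecidableEq Ω]

/-- An orthonormal basis of `L²(π)` that consists of eigenfunctions of `K`. -/
structure EigenBasis (π : Ω → ℝ) (K : Matrix Ω Ω ℝ) where
  /-- the eigenfunctions -/
  φ : Ω → Ω → ℝ
  /-- the eigenvalues -/
  ev : Ω → ℝ
  ortho : ∀ i j, ip π (φ i) (φ j) = if i = j then 1 else 0
  expand : ∀ f : Ω → ℝ, f = ∑ i, ip π f (φ i) • φ i
  eig : ∀ i, K.mulVec (φ i) = ev i • φ i

/-- Conjugation by `√π` turns `K` into a symmetric matrix `S`; its orthonormal eigenvectors divided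
by `√π` are the eigenfunctions. The matrix `K` need not be stochastic, so this also covers killed
chains. -/
theorem exists_eigenBasis {π : Ω → ℝ} (hπ : ∀ x, 0 < π x) {K : Matrix Ω Ω ℝ}
    (hK : ∀ x y, π x * K x y = π y * K y x) : Nonempty (EigenBasis π K) := by
  set r : Ω → ℝ := fun x => √(π x) with hr
  have hr0 : ∀ x, r x ≠ 0 := fun x => (Real.sqrt_pos.2 (hπ x)).ne'
  have hrr : ∀ x, r x * r x = π x := fun x => Real.mul_self_sqrt (hπ x).le
  let S : Matrix Ω Ω ℝ := Matrix.of fun x y => r x * K x y / r y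
  have hS : S.IsHermitian := by
    ext x y
    simp only [Matrix.conjTranspose_apply, star_trivial, S, Matrix.of_apply]
    rw [div_eq_div_iff (hr0 _) (hr0 _)]
    have := hK x y
    rw [← hrr, ← hrr] at this
    linear_combination -this
  let v : Ω → Ω → ℝ := fun i => (hS.eigenvectorBasis i).ofLp
  have hip : ∀ f g : Ω → ℝ, ip π f g = inner ℝ (WithLp.toLp 2 fun x => r x * f x : EuclideanSpace ℝ Ω)
      (WithLp.toLp 2 fun x => r x * g x) := by
    intro f g
    simp only [ip, PiLp.inner_apply, RCLike.inner_apply, conj_trivial, ← hrr]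
    exact Finset.sum_congr rfl fun x _ => by ring
  have hv : ∀ i, (WithLp.toLp 2 fun x => r x * (v i x / r x) : EuclideanSpace ℝ Ω)
      = hS.eigenvectorBasis i := by
    intro i
    ext x
    simp only [v]
    field_simp [hr0 x]
  refine ⟨⟨fun i x => v i x / r x, hS.eigenvalues, ?_, ?_, ?_⟩⟩
  · intro i j
    rw [hip, hv, hv]
    exact orthonormal_iff_ite.1 hS.eigenvectorBasis.orthonormal i j
  · intro f
    have h := hS.eigenvectorBasis.sum_repr' (WithLp.toLp 2 fun x => r x * f x : EuclideanSpace ℝ Ω)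
    funext x
    have hx := congrArg (fun w : EuclideanSpace ℝ Ω => w x) h
    simp only [WithLp.ofLp_sum, WithLp.ofLp_smul, Finset.sum_apply, Pi.smul_apply, smul_eq_mul]
      at hx
    simp only [Finset.sum_apply, Pi.smul_apply, smul_eq_mul, hip, hv]
    apply mul_left_cancel₀ (hr0 x)
    rw [← hx, Finset.mul_sum]
    refine Finset.sum_congr rfl fun i _ => ?_
    rw [real_inner_comm]
    simp only [v]
    field_simp [hr0 x]
  · intro i
    have h := hS.mulVec_eigenvectorBasis i
    funext x
    have hx := congrFun h x
    simp only [Matrix.mulVec, dotProduct, Pi.smul_apply, smul_eq_mul, S, Matrix.of_apply] at hx ⊢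
    apply mul_left_cancel₀ (hr0 x)
    rw [Finset.mul_sum, show r x * (hS.eigenvalues i * (v i x / r x)) = hS.eigenvalues i * v i x by
      field_simp [hr0 x], ← hx]
    refine Finset.sum_congr rfl fun y _ => ?_
    simp only [v]
    ring

/-! ### Functional calculus in an eigenbasis -/

namespace EigenBasis

variable {π : Ω → ℝ} {K : Matrix Ω Ω ℝ} (E : EigenBasis π K)

/-- Functional calculus: `q(K) f`. -/
def fn (q : ℝ → ℝ) (f : Ω → ℝ) : Ω → ℝ := ∑ i, (q (E.ev i) * ip π f (E.φ i)) • E.φ i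

theorem ip_fn (q : ℝ → ℝ) (f : Ω → ℝ) (i : Ω) :
    ip π (E.fn q f) (E.φ i) = q (E.ev i) * ip π f (E.φ i) := by
  simp [fn, ip_sum_left, ip_smul_left, E.ortho]

theorem fn_apply (q : ℝ → ℝ) (f : Ω → ℝ) (x : Ω) :
    E.fn q f x = ∑ i, q (E.ev i) * ip π f (E.φ i) * E.φ i x := by
  simp [fn, Finset.sum_apply]

theorem fn_fn (q₁ q₂ : ℝ → ℝ) (f : Ω → ℝ) :
    E.fn q₁ (E.fn q₂ f) = E.fn (fun x => q₁ x * q₂ x) f := by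
  rw [fn]
  simp only [ip_fn]
  exact Finset.sum_congr rfl fun i _ => by rw [mul_assoc]

theorem fn_one (f : Ω → ℝ) : E.fn (fun _ => 1) f = f := by
  conv_rhs => rw [E.expand f]
  simp [fn]

theorem ip_fn_right (q : ℝ → ℝ) (f g : Ω → ℝ) :
    ip π g (E.fn q f) = ∑ i, q (E.ev i) * ip π g (E.φ i) * ip π f (E.φ i) := by
  simp only [fn, ip_sum_right, ip_smul_right]
  exact Finset.sum_congr rfl fun i _ => by ring

theorem ip_fn_comm (q : ℝ → ℝ) (f g : Ω → ℝ) : ip π g (E.fn q f) = ip π (E.fn q g) f := by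
  rw [ip_comm π (E.fn q g), ip_fn_right, ip_fn_right]
  exact Finset.sum_congr rfl fun i _ => by ring

theorem ip_eq_sum (f g : Ω → ℝ) : ip π f g = ∑ i, ip π f (E.φ i) * ip π g (E.φ i) := by
  have h := E.ip_fn_right (fun _ => 1) g f
  rw [fn_one] at h
  simpa using h

theorem fn_add (q : ℝ → ℝ) (f g : Ω → ℝ) : E.fn q (f + g) = E.fn q f + E.fn q g := by
  simp only [fn, ip_add_left, ← Finset.sum_add_distrib]
  exact Finset.sum_congr rfl fun i _ => by rw [mul_add, add_smul]

theorem fn_smul (q : ℝ → ℝ) (c : ℝ) (f : Ω → ℝ) : E.fn q (c • f) = c • E.fn q f := by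
  simp only [fn, ip_smul_left, Finset.smul_sum, smul_smul]
  exact Finset.sum_congr rfl fun i _ => by ring_nf

theorem mulVec_fn (q : ℝ → ℝ) (f : Ω → ℝ) :
    K.mulVec (E.fn q f) = E.fn (fun x => x * q x) f := by
  simp only [fn, Matrix.mulVec_sum, Matrix.mulVec_smul, E.eig, smul_smul]
  exact Finset.sum_congr rfl fun i _ => by ring_nf

theorem fn_pow (n : ℕ) (f : Ω → ℝ) : E.fn (fun x => x ^ n) f = (K ^ n).mulVec f := by
  induction n with
  | zero => simp [fn_one]
  | succ n ih =>
    rw [pow_succ', ← Matrix.mulVec_mulVec, ← ih, mulVec_fn]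
    simp only [pow_succ']

theorem fn_eq_of_mulVec {q : ℝ → ℝ} {f : Ω → ℝ} {l : ℝ} (h : K.mulVec f = l • f) :
    E.fn q f = q l • f := by
  conv_rhs => rw [E.expand f]
  rw [fn, Finset.smul_sum]
  refine Finset.sum_congr rfl fun i _ => ?_
  rw [smul_smul]
  have h1 : E.ev i * ip π f (E.φ i) = l * ip π f (E.φ i) := by
    have h2 := E.ip_fn (fun x => x ^ 1) f i
    rw [fn_pow, pow_one, h, ip_smul_left] at h2
    simpa using h2.symm
  rcases mul_eq_mul_right_iff.1 h1 with h3 | h3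
  · rw [h3]
  · rw [h3]; simp

end EigenBasis

/-! ### The maximal inequality -/

/-- For `U` uniform on `(0, 1]`, the variable `∑ cᵢ 1{U ≤ sᵢ}` has mean `∑ cᵢ sᵢ`, and its second
moment is the right-hand side since `E[1{U ≤ sᵢ} 1{U ≤ sⱼ}] = min sᵢ sⱼ`. The inequality says that
its variance is nonnegative. -/
theorem sq_sum_le_sum_min {ι : Type*} (B : Finset ι) (c s : ι → ℝ) (h0 : ∀ i, 0 ≤ s i)
    (h1 : ∀ i, s i ≤ 1) :
    (∑ i ∈ B, c i * s i) ^ 2 ≤ ∑ i ∈ B, ∑ j ∈ B, c i * c j * min (s i) (s j) := by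
  let μ : Measure ℝ := volume.restrict (Set.Ioc 0 1)
  let I : ι → ℝ → ℝ := fun i => (Set.Iic (s i)).indicator 1
  have hm : ∀ r : ℝ, 0 ≤ r → r ≤ 1 → ∫ u, (Set.Iic r).indicator (1 : ℝ → ℝ) u ∂μ = r := by
    intro r hr0 hr1
    rw [integral_indicator_one measurableSet_Iic, measureReal_restrict_apply measurableSet_Iic,
      show Set.Iic r ∩ Set.Ioc 0 1 = Set.Ioc 0 r by
        ext u; simp only [Set.mem_inter_iff, Set.mem_Iic, Set.mem_Ioc]
        exact ⟨fun h => ⟨h.2.1, h.1⟩, fun h => ⟨h.2, h.1, h.2.trans hr1⟩⟩]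
    simp [hr0]
  have hII : ∀ i j u, I i u * I j u = (Set.Iic (min (s i) (s j))).indicator (1 : ℝ → ℝ) u := by
    intro i j u
    simp only [I]
    by_cases hi : u ≤ s i <;> by_cases hj : u ≤ s j <;> simp [hi, hj]
  have hint : ∀ r : ℝ, Integrable ((Set.Iic r).indicator (1 : ℝ → ℝ)) μ := fun r =>
    (integrable_const (1 : ℝ)).indicator measurableSet_Iic
  set a := ∑ i ∈ B, c i * s i with ha
  have e1 : ∫ u, (∑ i ∈ B, c i * I i u) ∂μ = a := by
    rw [integral_finsetSum _ fun i _ => (hint _).const_mul _]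
    refine Finset.sum_congr rfl fun i _ => ?_
    rw [integral_const_mul, hm _ (h0 i) (h1 i)]
  have e2 : ∫ u, (∑ i ∈ B, ∑ j ∈ B, c i * c j * (I i u * I j u)) ∂μ
      = ∑ i ∈ B, ∑ j ∈ B, c i * c j * min (s i) (s j) := by
    simp only [hII]
    rw [integral_finsetSum _ fun i _ => integrable_finsetSum _ fun j _ => (hint _).const_mul _]
    refine Finset.sum_congr rfl fun i _ => ?_
    rw [integral_finsetSum _ fun j _ => (hint _).const_mul _]
    refine Finset.sum_congr rfl fun j _ => ?_
    rw [integral_const_mul, hm _ (le_min (h0 i) (h0 j)) ((min_le_left _ _).trans (h1 i))]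
  have i1 : Integrable (fun u => ∑ i ∈ B, c i * I i u) μ :=
    integrable_finsetSum _ fun i _ => (hint _).const_mul _
  have i2 : Integrable (fun u => ∑ i ∈ B, ∑ j ∈ B, c i * c j * (I i u * I j u)) μ := by
    simp only [hII]
    exact integrable_finsetSum _ fun i _ => integrable_finsetSum _ fun j _ =>
      (hint _).const_mul _
  have h := integral_nonneg (μ := μ) (f := fun u => ((∑ i ∈ B, c i * I i u) - a) ^ 2)
    fun u => sq_nonneg _
  have e3 : ∀ u, ((∑ i ∈ B, c i * I i u) - a) ^ 2 =
      (∑ i ∈ B, ∑ j ∈ B, c i * c j * (I i u * I j u)) - 2 * a * (∑ i ∈ B, c i * I i u) + a ^ 2 := by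
    intro u
    have : (∑ i ∈ B, ∑ j ∈ B, c i * c j * (I i u * I j u)) = (∑ i ∈ B, c i * I i u) ^ 2 := by
      rw [pow_two, Finset.sum_mul_sum]
      exact Finset.sum_congr rfl fun i _ => Finset.sum_congr rfl fun j _ => by ring
    rw [this]; ring
  simp only [e3] at h
  have e4 := integral_add (i2.sub (i1.const_mul (2 * a))) (integrable_const (a ^ 2))
  have e5 := integral_sub i2 (i1.const_mul (2 * a))
  simp only [Pi.sub_apply] at e4 e5
  rw [e4, e5, integral_const_mul, e1, e2] at h
  simp [μ] at h
  nlinarith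

variable {T : Type*} [LinearOrder T]

/-- The maximal function is linearised by a choice of time `t y` at each point `y`. By duality it
suffices to bound the norm of `k`, the adjoint of the linearised operator applied to the indicator
`b` of `B`. The key estimate is `‖k‖² ≤ 2⟨b, k⟩`. -/
theorem EigenBasis.maximal {π : Ω → ℝ} {K : Matrix Ω Ω ℝ} (E : EigenBasis π K)
    (hπ : ∀ x, 0 ≤ π x) (q : T → ℝ → ℝ) (hq0 : ∀ t i, 0 ≤ q t (E.ev i))
    (hq1 : ∀ t i, q t (E.ev i) ≤ 1) (hanti : ∀ i, Antitone fun t => q t (E.ev i))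
    (hpos : ∀ t f, (∀ x, 0 ≤ f x) → ∀ x, 0 ≤ E.fn (q t) f x)
    (B : Finset Ω) (t : Ω → T) (f : Ω → ℝ) :
    (∑ y ∈ B, π y * |E.fn (q (t y)) f y|) ^ 2 ≤ 4 * (∑ y ∈ B, π y) * ip π f f := by
  let δ : Ω → Ω → ℝ := fun y => Pi.single y 1
  have hδ : ∀ y x, 0 ≤ δ y x := fun y x => by
    by_cases h : x = y
    · subst h; simp [δ]
    · simp [δ, Pi.single_eq_of_ne h]
  let k : Ω → ℝ := ∑ y ∈ B, E.fn (q (t y)) (δ y)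
  let b : Ω → ℝ := ∑ y ∈ B, δ y
  have hkφ : ∀ i, ip π k (E.φ i) = ∑ y ∈ B, ip π (δ y) (E.φ i) * q (t y) (E.ev i) := by
    intro i
    simp only [k, ip_sum_left, E.ip_fn]
    exact Finset.sum_congr rfl fun y _ => mul_comm _ _
  have hδip : ∀ y z s, 0 ≤ ip π (δ y) (E.fn (q s) (δ z)) := by
    intro y z s
    rw [ip_single_left]
    exact mul_nonneg (hπ y) (hpos s _ (hδ z) y)
  have hb : ip π b b = ∑ y ∈ B, π y := by
    simp only [b, ip_sum_left, ip_single_left, δ, Finset.sum_apply]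
    refine Finset.sum_congr rfl fun y hy => ?_
    rw [Finset.sum_eq_single_of_mem y hy fun z _ hz => Pi.single_eq_of_ne hz.symm _]
    simp
  have hbk : ip π b k = ∑ y ∈ B, ∑ z ∈ B, ip π (δ y) (E.fn (q (t z)) (δ z)) := by
    simp only [b, k, ip_sum_left]
    exact Finset.sum_congr rfl fun y _ => ip_sum_right _ _ _ _
  have hkk : ip π k k ≤ 2 * ip π b k := by
    calc ip π k k = ∑ i, (∑ y ∈ B, ip π (δ y) (E.φ i) * q (t y) (E.ev i)) ^ 2 := by
          rw [E.ip_eq_sum]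
          exact Finset.sum_congr rfl fun i _ => by rw [hkφ, pow_two]
      _ ≤ ∑ i, ∑ y ∈ B, ∑ z ∈ B, ip π (δ y) (E.φ i) * ip π (δ z) (E.φ i) *
            min (q (t y) (E.ev i)) (q (t z) (E.ev i)) :=
          Finset.sum_le_sum fun i _ => sq_sum_le_sum_min B _ _ (fun y => hq0 _ _)
            fun y => hq1 _ _
      -- The multipliers decrease in time, so the smaller of two values is the value at the later
      -- time.
      _ = ∑ y ∈ B, ∑ z ∈ B, ip π (δ y) (E.fn (q (max (t y) (t z))) (δ z)) := by
          rw [Finset.sum_comm]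
          refine Finset.sum_congr rfl fun y _ => ?_
          rw [Finset.sum_comm]
          refine Finset.sum_congr rfl fun z _ => ?_
          rw [E.ip_fn_right]
          refine Finset.sum_congr rfl fun i _ => ?_
          rw [(hanti i).map_max]
          ring
      -- The kernel at the later time is one of the two summands, and the other is nonnegative.
      _ ≤ ∑ y ∈ B, ∑ z ∈ B, (ip π (δ y) (E.fn (q (t z)) (δ z)) +
            ip π (δ z) (E.fn (q (t y)) (δ y))) := by
          refine Finset.sum_le_sum fun y _ => Finset.sum_le_sum fun z _ => ?_
          rcases le_total (t y) (t z) with h | h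
          · rw [max_eq_right h]
            linarith [hδip z y (t y)]
          · rw [max_eq_left h, E.ip_fn_comm, ip_comm]
            linarith [hδip y z (t z)]
      _ = 2 * ip π b k := by
          simp only [Finset.sum_add_distrib]
          rw [hbk, two_mul]
          congr 1
          exact Finset.sum_comm
  -- Cauchy–Schwarz gives `‖k‖² ≤ 2‖b‖‖k‖`; cancelling `‖k‖` produces the constant `4`.
  have hk4 : ip π k k ≤ 4 * ∑ y ∈ B, π y := by
    have h0 := ip_self_nonneg hπ k
    have h1 := ip_sq_le hπ b k
    rw [hb] at h1
    have h2 : ip π k k ^ 2 ≤ 4 * (∑ y ∈ B, π y) * ip π k k := by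
      nlinarith
    rcases h0.eq_or_lt with h3 | h3
    · rw [← h3]
      exact mul_nonneg (by norm_num) (Finset.sum_nonneg fun y _ => hπ y)
    · nlinarith
  have habs : ∀ s y, |E.fn (q s) f y| ≤ E.fn (q s) (fun x => |f x|) y := by
    intro s y
    rw [abs_le]
    constructor
    · have := hpos s ((fun x => |f x|) + f) (fun x => by
        simp only [Pi.add_apply]; linarith [neg_abs_le (f x)]) y
      rw [E.fn_add, Pi.add_apply] at this
      linarith
    · have := hpos s ((fun x => |f x|) + (-1 : ℝ) • f) (fun x => by
        simp only [Pi.add_apply, Pi.smul_apply, smul_eq_mul]; linarith [le_abs_self (f x)]) y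
      rw [E.fn_add, E.fn_smul, Pi.add_apply, Pi.smul_apply, smul_eq_mul] at this
      linarith
  have hfin : ∑ y ∈ B, π y * |E.fn (q (t y)) f y| ≤ ip π k (fun x => |f x|) := by
    simp only [k, ip_sum_left]
    refine Finset.sum_le_sum fun y _ => ?_
    rw [← E.ip_fn_comm, ip_single_left]
    exact mul_le_mul_of_nonneg_left (habs _ _) (hπ y)
  have hff : ip π (fun x => |f x|) (fun x => |f x|) = ip π f f :=
    Finset.sum_congr rfl fun x _ => by rw [mul_assoc, abs_mul_abs_self, mul_assoc]
  calc (∑ y ∈ B, π y * |E.fn (q (t y)) f y|) ^ 2 ≤ ip π k (fun x => |f x|) ^ 2 :=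
        pow_le_pow_left₀ (Finset.sum_nonneg fun y _ => mul_nonneg (hπ y) (abs_nonneg _)) hfin 2
    _ ≤ ip π k k * ip π f f := by rw [← hff]; exact ip_sq_le hπ _ _
    _ ≤ 4 * (∑ y ∈ B, π y) * ip π f f :=
        mul_le_mul_of_nonneg_right hk4 (ip_self_nonneg hπ f)

end FiniteChain

namespace FiniteChain

variable {Ω : Type*}

/-! ### Total variation distance and indicators -/

/-- The indicator function of a finite set. -/
def ind [DecidableEq Ω] (A : Finset Ω) : Ω → ℝ := fun y => if y ∈ A then 1 else 0

theorem ind_nonneg [DecidableEq Ω] (A : Finset Ω) (x : Ω) : 0 ≤ ind A x := by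
  unfold ind; split_ifs <;> norm_num

theorem ind_le_one [DecidableEq Ω] (A : Finset Ω) (x : Ω) : ind A x ≤ 1 := by
  unfold ind; split_ifs <;> norm_num

theorem ind_mul_ind [DecidableEq Ω] (A : Finset Ω) (x : Ω) : ind A x * ind A x = ind A x := by
  unfold ind; split_ifs <;> simp

variable [Fintype Ω]

theorem sum_mul_ind [DecidableEq Ω] (A : Finset Ω) (f : Ω → ℝ) :
    ∑ y, f y * ind A y = ∑ y ∈ A, f y := by
  simp [ind, Finset.sum_ite_mem]

theorem mulVec_ind [DecidableEq Ω] (M : Matrix Ω Ω ℝ) (A : Finset Ω) (x : Ω) :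
    M.mulVec (ind A) x = ∑ y ∈ A, M x y := by
  rw [Matrix.mulVec, dotProduct, sum_mul_ind]

theorem tvDist_le {μ ν : Ω → ℝ} (hμ : ∑ y, μ y = 1) (hν : ∑ y, ν y = 1) {δ : ℝ}
    (h : ∀ A : Finset Ω, ∑ y ∈ A, ν y - ∑ y ∈ A, μ y ≤ δ) : tvDist μ ν ≤ δ := by
  classical
  have h1 := h (Finset.univ.filter fun y => μ y ≤ ν y)
  have h2 : ∀ y, |μ y - ν y| = 2 * (if μ y ≤ ν y then ν y - μ y else 0) + (μ y - ν y) := by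
    intro y
    split_ifs with hy
    · rw [abs_of_nonpos (by linarith)]; ring
    · rw [abs_of_nonneg (by linarith)]; ring
  simp only [tvDist, h2, Finset.sum_add_distrib, ← Finset.mul_sum, Finset.sum_sub_distrib, hμ, hν]
  rw [← Finset.sum_filter, Finset.sum_sub_distrib]
  linarith

/-- Both measures have mass one, so `f` may be replaced by `f - 1/2`, which is at most `1/2` in
absolute value; this is the factor in `tvDist`. -/
theorem sum_mul_sub_le_tvDist {μ ν f : Ω → ℝ} (hμ : ∑ y, μ y = 1) (hν : ∑ y, ν y = 1)
    (h0 : ∀ y, 0 ≤ f y) (h1 : ∀ y, f y ≤ 1) :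
    ∑ y, μ y * f y - ∑ y, ν y * f y ≤ tvDist μ ν := by
  have h : ∑ y, μ y * f y - ∑ y, ν y * f y =
      ∑ y, (μ y - ν y) * (f y - 1 / 2) := by
    have : ∑ y, (μ y - ν y) * (f y - 1 / 2) =
        ∑ y, μ y * f y - ∑ y, ν y * f y - (1 / 2) * (∑ y, μ y - ∑ y, ν y) := by
      rw [← Finset.sum_sub_distrib, ← Finset.sum_sub_distrib, Finset.mul_sum,
        ← Finset.sum_sub_distrib]
      exact Finset.sum_congr rfl fun y _ => by ring
    rw [this, hμ, hν]; ring
  rw [h, tvDist, Finset.mul_sum]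
  refine Finset.sum_le_sum fun y _ => ?_
  refine (le_abs_self _).trans ?_
  rw [abs_mul, mul_comm]
  refine mul_le_mul_of_nonneg_right ?_ (abs_nonneg _)
  rw [abs_le]
  constructor <;> linarith [h0 y, h1 y]

theorem sum_mul_sub_le_two_mul_tvDist {μ ν f : Ω → ℝ} {C : ℝ} (hf : ∀ y, |f y| ≤ C) :
    |∑ y, μ y * f y - ∑ y, ν y * f y| ≤ 2 * tvDist μ ν * C := by
  rw [← Finset.sum_sub_distrib, tvDist]
  refine (Finset.abs_sum_le_sum_abs _ _).trans ?_
  rw [show 2 * (1 / 2 * ∑ y, |μ y - ν y|) * C = ∑ y, |μ y - ν y| * C by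
    rw [← Finset.sum_mul]; ring]
  refine Finset.sum_le_sum fun y _ => ?_
  rw [← sub_mul, abs_mul]
  exact mul_le_mul_of_nonneg_left (hf y) (abs_nonneg _)

/-- `d(t) ≤ δ` -/
def MixLe {T : Type*} (π : Ω → ℝ) (M : T → Matrix Ω Ω ℝ) (t : T) (δ : ℝ) : Prop :=
  ∀ x, tvDist (fun y => M t x y) π ≤ δ

/-- Evaluate `M t f = l f` at a point where `|f|` is maximal; since `π(f) = 0`, the value differs
from zero by at most twice the distance times `max |f|`. -/
theorem abs_le_two_mul_of_mixLe {T : Type*} {π : Ω → ℝ} {M : T → Matrix Ω Ω ℝ} {t : T} {δ l : ℝ} (ht : MixLe π M t δ) {f : Ω → ℝ} (hf : f ≠ 0)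
    (hf1 : ip π f 1 = 0) (hl : (M t).mulVec f = l • f) : |l| ≤ 2 * δ := by
  obtain ⟨z, hz⟩ := Function.ne_iff.1 hf
  have : Nonempty Ω := ⟨z⟩
  obtain ⟨x, hx⟩ := Finite.exists_max fun y => |f y|
  have hx0 : 0 < |f x| := (abs_pos.2 hz).trans_le (hx z)
  have h := sum_mul_sub_le_two_mul_tvDist (μ := fun y => M t x y) (ν := π) hx
  have h1 : ∑ y, π y * f y = 0 := by simpa [ip] using hf1
  have h2 : ∑ y, M t x y * f y = l * f x := congrFun hl x
  rw [h1, h2, sub_zero, abs_mul] at h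
  have h3 := le_of_mul_le_mul_right h hx0
  linarith [ht x]

variable [DecidableEq Ω] {T : Type*} [AddCommMonoid T]

/-! ### Mixing and hitting for reversible semigroups -/

/-- The facts on a reversible Markov semigroup `M` (in discrete or continuous time) with spectral
gap `g`, and on the tails `tail t A x = Pₓ[T_A > t]` of its hitting times, that relate mixing and
hitting. The function `τ` is the inclusion of the times into the reals. -/
structure HittingSystem (π : Ω → ℝ) (g : ℝ) (τ : T → ℝ) (M : T → Matrix Ω Ω ℝ)
    (tail : T → Finset Ω → Ω → ℝ) : Prop where
  π_pos : ∀ x, 0 < π x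
  π_sum : ∑ x, π x = 1
  gap_pos : 0 < g
  unbounded : ∀ R : ℝ, ∃ t, R ≤ τ t
  nonneg : ∀ t x y, 0 ≤ M t x y
  row_sum : ∀ t x, ∑ y, M t x y = 1
  add : ∀ s t, M (s + t) = M s * M t
  -- Maximal inequality in linearised form: the time `r y` may depend on the point.
  maximal : ∀ (B : Finset Ω) (r : Ω → T) (f : Ω → ℝ),
    (∑ y ∈ B, π y * |(M (r y)).mulVec f y|) ^ 2 ≤ 4 * (∑ y ∈ B, π y) * ip π f f
  contraction : ∀ s f, ip π f 1 = 0 →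
    ip π ((M s).mulVec f) ((M s).mulVec f) ≤ Real.exp (-(2 * (g * τ s))) * ip π f f
  tail_nonneg : ∀ t A x, 0 ≤ tail t A x
  tail_le_one : ∀ t A x, tail t A x ≤ 1
  tail_le : ∀ t A x, tail t A x ≤ (M t).mulVec (ind Aᶜ) x
  tail_add : ∀ s t A x, tail (t + s) A x ≤ (M t).mulVec (tail s A) x
  tail_stat : ∀ s A, ∑ x, π x * tail s A x ≤
    (1 - ∑ y ∈ A, π y) * Real.exp (-((∑ y ∈ A, π y) * (g * τ s)))
  -- The lower bound on `G` is required for every `r` because the time left after hitting `G` is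
  -- random.
  strongMarkov : ∀ (s : T) (G : Finset Ω) (f : Ω → ℝ) (c : ℝ), (∀ x, 0 ≤ f x) →
    (∀ r, ∀ y ∈ G, c ≤ (M (r + s)).mulVec f y) →
    ∀ t x, c * (1 - tail t G x) ≤ (M (t + s)).mulVec f x

/-- `p(α, t) ≤ p` -/
def HitLe (π : Ω → ℝ) (tail : T → Finset Ω → Ω → ℝ) (t : T) (α p : ℝ) : Prop :=
  ∀ x A, α ≤ ∑ y ∈ A, π y → tail t A x ≤ p

namespace HittingSystem

variable {π : Ω → ℝ} {g : ℝ} {τ : T → ℝ} {M : T → Matrix Ω Ω ℝ} {tail : T → Finset Ω → Ω → ℝ}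

theorem measure_le_one (H : HittingSystem π g τ M tail) (A : Finset Ω) : ∑ y ∈ A, π y ≤ 1 := by
  rw [← H.π_sum]
  exact Finset.sum_le_univ_sum_of_nonneg fun x => (H.π_pos x).le

theorem measure_nonneg (H : HittingSystem π g τ M tail) (A : Finset Ω) : 0 ≤ ∑ y ∈ A, π y :=
  Finset.sum_nonneg fun x _ => (H.π_pos x).le

theorem measure_compl (H : HittingSystem π g τ M tail) (A : Finset Ω) :
    ∑ y ∈ Aᶜ, π y = 1 - ∑ y ∈ A, π y := by
  rw [← H.π_sum, ← Finset.sum_add_sum_compl A]; ring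

/-- The hypothesis `hA` is what the maximal inequality and the contraction need to give the
exceptional set `B` measure at most `1 - α`. The witness `u` is the tail of the hitting time of
`Bᶜ`, and the bound rearranges `(a - m)(1 - u) ≤ M_{t+s}(x, A)`. Keeping `u` explicit lets the sign
of `a - m` be treated later. -/
theorem exists_tail_of_hitLe (H : HittingSystem π g τ M tail) {s t : T} {m α p : ℝ} (hm : 0 < m)
    (hα : α ≤ 1) (hp : HitLe π tail t α p) (A : Finset Ω)
    (hA : 4 * Real.exp (-(2 * (g * τ s))) * ((∑ y ∈ A, π y) * (1 - ∑ y ∈ A, π y))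
      ≤ m ^ 2 * (1 - α)) (x : Ω) :
    ∃ u, 0 ≤ u ∧ u ≤ p ∧
      ∑ y ∈ A, π y - ∑ y ∈ A, M (t + s) x y ≤ m + (∑ y ∈ A, π y - m) * u := by
  classical
  set a := ∑ y ∈ A, π y with ha
  let f : Ω → ℝ := ind A - a • 1
  have hM1 : ∀ t, (M t).mulVec 1 = 1 := fun t => by
    funext x
    simp [Matrix.mulVec, dotProduct, H.row_sum]
  have hi1 : ip π (ind A) 1 = a := by
    rw [ha, ← sum_mul_ind A π, ip]; simp
  have hii : ip π (ind A) (ind A) = a := by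
    rw [ha, ← sum_mul_ind A π, ip]
    exact Finset.sum_congr rfl fun y _ => by unfold ind; split_ifs <;> simp
  have h11 : ip π (1 : Ω → ℝ) 1 = 1 := by simp [ip, H.π_sum]
  have hf1 : ip π f 1 = 0 := by
    rw [ip_sub_left, ip_smul_left, hi1, h11]; ring
  have hff : ip π f f = a * (1 - a) := by
    rw [ip_comm, ip_sub_left π _ _ f, ip_smul_left, ip_comm π 1, hf1, ip_comm, ip_sub_left,
      ip_smul_left, hii, ip_comm π 1, hi1]
    ring
  have hMf : ∀ r y, (M r).mulVec ((M s).mulVec f) y = (M (r + s)).mulVec (ind A) y - a := by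
    intro r y
    rw [Matrix.mulVec_mulVec, ← H.add, Matrix.mulVec_sub, Matrix.mulVec_smul, hM1]
    simp
  -- Points where the maximal function of `M_s f` exceeds `m`; a witnessing time `r y` is then
  -- chosen at each of them.
  let B : Finset Ω := Finset.univ.filter fun y => ∃ r, m < |(M (r + s)).mulVec (ind A) y - a|
  have hB : ∀ y, ∃ r, y ∈ B → m < |(M (r + s)).mulVec (ind A) y - a| := by
    intro y
    by_cases hy : y ∈ B
    · obtain ⟨r, hr⟩ := (Finset.mem_filter.1 hy).2
      exact ⟨r, fun _ => hr⟩
    · exact ⟨0, fun h => absurd h hy⟩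
  choose r hr using hB
  have hπB : ∑ y ∈ B, π y ≤ 1 - α := by
    set b := ∑ y ∈ B, π y with hb
    have hb0 : 0 ≤ b := H.measure_nonneg B
    have h1 : m * b ≤ ∑ y ∈ B, π y * |(M (r y)).mulVec ((M s).mulVec f) y| := by
      rw [hb, Finset.mul_sum]
      refine Finset.sum_le_sum fun y hy => ?_
      rw [hMf, mul_comm]
      exact mul_le_mul_of_nonneg_left (hr y hy).le (H.π_pos y).le
    have h2 := (pow_le_pow_left₀ (mul_nonneg hm.le hb0) h1 2).trans (H.maximal B r _)
    have h3 := H.contraction s f hf1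
    rw [hff] at h3
    have h4 : (m * b) ^ 2 ≤ b * (m ^ 2 * (1 - α)) := by
      refine h2.trans ?_
      rw [← hb]
      have := mul_le_mul_of_nonneg_left h3 hb0
      have := mul_le_mul_of_nonneg_left hA hb0
      linarith
    rcases hb0.eq_or_lt with h5 | h5
    · rw [← h5]; linarith
    · have h6 : b * m ^ 2 * b ≤ b * m ^ 2 * (1 - α) := by linarith
      exact le_of_mul_le_mul_left h6 (by positivity)
  have hG : α ≤ ∑ y ∈ Bᶜ, π y := by
    rw [H.measure_compl]; linarith
  refine ⟨tail t Bᶜ x, H.tail_nonneg _ _ _, hp x _ hG, ?_⟩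
  have h := H.strongMarkov s Bᶜ (ind A) (a - m) (ind_nonneg A) (fun r y hy => by
    have : ¬ ∃ r, m < |(M (r + s)).mulVec (ind A) y - a| := by
      simpa [B] using hy
    push Not at this
    linarith [(abs_le.1 (this r)).1]) t x
  rw [mulVec_ind] at h
  linarith

theorem mixLe_of_forall (H : HittingSystem π g τ M tail) {t : T} {δ : ℝ}
    (h : ∀ (x : Ω) (A : Finset Ω), ∑ y ∈ A, π y - ∑ y ∈ A, M t x y ≤ δ) : MixLe π M t δ :=
  fun x => tvDist_le (H.row_sum t x) H.π_sum (h x)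

/-- Take `m = ε/2`: with `e^{-2gs} ≤ (ε/4)²` and `a(1-a) ≤ 1/4`, the requirement reads `ε²/16 ≤
ε²/8`. The error is at most `m + u ≤ ε/2 + ε/2`. -/
theorem mixLe_of_hitLe_half (H : HittingSystem π g τ M tail) {s t : T} {ε : ℝ} (hε0 : 0 < ε)
    (hε : ε ≤ 1 / 4) (ht : HitLe π tail t (1 / 2) (ε / 2)) (hs : Real.log (4 / ε) ≤ g * τ s) :
    MixLe π M (t + s) ε := by
  refine H.mixLe_of_forall fun x A => ?_
  have h4 : Real.exp (-(2 * (g * τ s))) ≤ (ε / 4) ^ 2 := by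
    calc Real.exp (-(2 * (g * τ s))) ≤ Real.exp (-(2 * Real.log (4 / ε))) :=
          Real.exp_le_exp.2 (by linarith)
      _ = (ε / 4) ^ 2 := by
          rw [show -(2 * Real.log (4 / ε)) = Real.log (ε / 4) + Real.log (ε / 4) by
            rw [← inv_div, Real.log_inv]; ring, Real.exp_add, Real.exp_log (by positivity)]
          ring
  obtain ⟨u, hu0, hu, h⟩ := H.exists_tail_of_hitLe (s := s) (m := ε / 2) (by positivity)
    (by norm_num) ht A (by
      have h5 : (∑ y ∈ A, π y) * (1 - ∑ y ∈ A, π y) ≤ 1 / 4 := by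
        nlinarith [sq_nonneg (∑ y ∈ A, π y - 1 / 2)]
      have h6 := mul_le_mul h4 h5 (mul_nonneg (H.measure_nonneg A)
        (sub_nonneg.2 (H.measure_le_one A))) (by positivity)
      nlinarith [sq_nonneg ε]) x
  have := H.measure_le_one A
  nlinarith

/-- Take `m = ε/4`: the exceptional set may only have measure `ε/4`, which costs a third factor
`ε/4` and hence the constant `3/2`. The error is at most `ε/4 + 3ε/4`. -/
theorem mixLe_of_hitLe (H : HittingSystem π g τ M tail) {s t : T} {ε : ℝ} (hε0 : 0 < ε)
    (hε : ε ≤ 1 / 4) (ht : HitLe π tail t (1 - ε / 4) (3 * ε / 4))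
    (hs : 3 / 2 * Real.log (4 / ε) ≤ g * τ s) :
    MixLe π M (t + s) ε := by
  refine H.mixLe_of_forall fun x A => ?_
  have h4 : Real.exp (-(2 * (g * τ s))) ≤ (ε / 4) ^ 3 := by
    calc Real.exp (-(2 * (g * τ s))) ≤ Real.exp (-(3 * Real.log (4 / ε))) :=
          Real.exp_le_exp.2 (by linarith)
      _ = (ε / 4) ^ 3 := by
          rw [show -(3 * Real.log (4 / ε)) =
            Real.log (ε / 4) + Real.log (ε / 4) + Real.log (ε / 4) by
            rw [← inv_div, Real.log_inv]; ring, Real.exp_add, Real.exp_add,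
            Real.exp_log (by positivity)]
          ring
  obtain ⟨u, hu0, hu, h⟩ := H.exists_tail_of_hitLe (s := s) (m := ε / 4) (by positivity)
    (by linarith) ht A (by
      have h5 : (∑ y ∈ A, π y) * (1 - ∑ y ∈ A, π y) ≤ 1 / 4 := by
        nlinarith [sq_nonneg (∑ y ∈ A, π y - 1 / 2)]
      have h6 := mul_le_mul h4 h5 (mul_nonneg (H.measure_nonneg A)
        (sub_nonneg.2 (H.measure_le_one A))) (by positivity)
      linarith) x
  have := H.measure_le_one A
  nlinarith

/-- With a wait of only one relaxation time, `m` is not small and has to depend on `a`: it must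
satisfy `m² ≥ 8e^{-2} a(1-a)`, where `8e^{-2} < 11/10`. -/
theorem mixLe_one_sub_of_hitLe (H : HittingSystem π g τ M tail) {s t : T} {ε : ℝ} (hε0 : 0 < ε)
    (hε : ε ≤ 1 / 4) (ht : HitLe π tail t (1 / 2) (1 - 2 * ε)) (hs : 1 ≤ g * τ s) :
    MixLe π M (t + s) (1 - ε) := by
  refine H.mixLe_of_forall fun x A => ?_
  have h4 : 8 * Real.exp (-(2 * (g * τ s))) ≤ 11 / 10 := by
    have h5 : Real.exp (-(2 * (g * τ s))) ≤ Real.exp (-2) := Real.exp_le_exp.2 (by linarith)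
    have h6 : Real.exp (-2) * (Real.exp 1 * Real.exp 1) = 1 := by
      rw [← Real.exp_add, ← Real.exp_add]; norm_num
    have h7 := Real.exp_one_gt_d9
    have h8 : (2.718 : ℝ) * 2.718 ≤ Real.exp 1 * Real.exp 1 := by nlinarith
    have h9 := mul_le_mul_of_nonneg_left h8 (Real.exp_pos (-2)).le
    rw [h6] at h9
    linarith
  set a := ∑ y ∈ A, π y with ha
  have ha0 : 0 ≤ a := H.measure_nonneg A
  have ha1 : a ≤ 1 := H.measure_le_one A
  have haa : 0 ≤ a * (1 - a) := mul_nonneg ha0 (sub_nonneg.2 ha1)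
  -- The term `1/100` keeps `m` positive when `a` is `0` or `1`, and is small enough for `a + m ≤
  -- 3/2`.
  obtain ⟨m, hm, hm2⟩ : ∃ m : ℝ, 0 < m ∧ m ^ 2 = 11 / 10 * (a * (1 - a)) + 1 / 100 :=
    ⟨√(11 / 10 * (a * (1 - a)) + 1 / 100), Real.sqrt_pos.2 (by positivity),
      Real.sq_sqrt (by positivity)⟩
  obtain ⟨u, hu0, hu, h⟩ := H.exists_tail_of_hitLe (s := s) hm (by norm_num) ht A (by
    rw [← ha, hm2]
    have := mul_le_mul_of_nonneg_right h4 haa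
    linarith) x
  rw [← ha] at h
  refine h.trans ?_
  have hm1 : m ≤ 3 / 4 := by nlinarith [sq_nonneg (a - 1 / 2)]
  have hm3 : a + m ≤ 3 / 2 := by
    by_contra! hc
    have : (3 / 2 - a) ^ 2 < m ^ 2 := by nlinarith
    nlinarith [sq_nonneg (a - 1)]
  rcases le_total m a with hma | hma
  · have h1 := mul_le_mul_of_nonneg_left hu (sub_nonneg.2 hma)
    -- The left side is affine in `ε`. If its slope is nonnegative, the worst case is `ε = 1/4`,
    -- where the claim is exactly `a + m ≤ 3/2`.
    have h2 : a - 1 + ε * (2 * m - 2 * a + 1) ≤ 0 := by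
      rcases le_total (2 * m - 2 * a + 1) 0 with h3 | h3
      · nlinarith
      · nlinarith
    linarith
  · nlinarith

/-- Let the chain mix until `t` and then count avoidance of `A` only during the last `s` units of
time. The stationary tail is at most `ε/2`, since `π(A) ≥ 1/2` and `g s ≥ 2|log ε|`. -/
theorem hitLe_add_of_mixLe (H : HittingSystem π g τ M tail) {s t : T} {ε δ : ℝ} (hε0 : 0 < ε)
    (ht : MixLe π M t δ) (hs : 2 * |Real.log ε| ≤ g * τ s) :
    HitLe π tail (t + s) (1 / 2) (δ + ε / 2) := by
  intro x A hA
  have h1 := sum_mul_sub_le_tvDist (μ := fun y => M t x y) (H.row_sum t x) H.π_sum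
    (H.tail_nonneg s A) (H.tail_le_one s A)
  have h2 := H.tail_add s t A x
  have h3 := ht x
  have h4 := H.tail_stat s A
  have h5 : Real.exp (-((∑ y ∈ A, π y) * (g * τ s))) ≤ ε := by
    rw [← Real.le_log_iff_exp_le hε0]
    have h6 := mul_le_mul hA hs (by positivity) (H.measure_nonneg A)
    have h7 := neg_abs_le (Real.log ε)
    linarith
  have h8 : (1 - ∑ y ∈ A, π y) * Real.exp (-((∑ y ∈ A, π y) * (g * τ s))) ≤ 1 / 2 * ε :=
    mul_le_mul (by linarith) h5 (Real.exp_pos _).le (by norm_num)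
  simp only [Matrix.mulVec, dotProduct] at h2
  linarith

/-- Avoiding `A` up to time `t` forces the chain to be outside `A` at time `t`, which has
probability at most `π(Aᶜ) + ε ≤ ε/4 + ε`. -/
theorem hitLe_of_mixLe (H : HittingSystem π g τ M tail) {t : T} {ε : ℝ} (ht : MixLe π M t ε) :
    HitLe π tail t (1 - ε / 4) (5 * ε / 4) := by
  intro x A hA
  have h1 := sum_mul_sub_le_tvDist (μ := fun y => M t x y) (H.row_sum t x) H.π_sum
    (ind_nonneg Aᶜ) (ind_le_one Aᶜ)
  have h2 := H.tail_le t A x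
  have h3 := ht x
  rw [sum_mul_ind Aᶜ π, H.measure_compl] at h1
  simp only [Matrix.mulVec, dotProduct] at h2
  linarith

/-- Guarantees that the sets whose infima define hitting and mixing times are nonempty; an empty set
would have the infimum `0` by default. A stationary tail bounds each pointwise tail up to the factor
`1 / min π`. -/
theorem exists_hitLe (H : HittingSystem π g τ M tail) {α p : ℝ} (hα : 0 < α) (hp : 0 < p) :
    ∃ t, HitLe π tail t α p := by
  rcases isEmpty_or_nonempty Ω with hΩ | hΩ
  · exact ⟨0, fun x => (IsEmpty.false x).elim⟩
  obtain ⟨x₀, hx₀⟩ := Finite.exists_min π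
  have hc : 0 < π x₀ := H.π_pos x₀
  obtain ⟨t, ht⟩ := H.unbounded (-Real.log (p * π x₀) / (g * α))
  refine ⟨t, fun x A hA => ?_⟩
  have hgα : 0 < g * α := mul_pos H.gap_pos hα
  rw [div_le_iff₀ hgα] at ht
  have h1 := H.tail_stat t A
  have h2 : π x * tail t A x ≤ ∑ x, π x * tail t A x :=
    Finset.single_le_sum (f := fun x => π x * tail t A x)
      (fun y _ => mul_nonneg (H.π_pos y).le (H.tail_nonneg t A y)) (Finset.mem_univ x)
  have h3 : π x₀ * tail t A x ≤ π x * tail t A x :=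
    mul_le_mul_of_nonneg_right (hx₀ x) (H.tail_nonneg t A x)
  -- The function `τ` carries no sign condition; if `g * τ t < 0`, the choice of `t` forces `p ≥ 1`
  -- and the bound is trivial.
  by_cases hneg : 0 ≤ g * τ t
  · have h4 : (1 - ∑ y ∈ A, π y) * Real.exp (-((∑ y ∈ A, π y) * (g * τ t))) ≤
        1 * Real.exp (-(α * (g * τ t))) :=
      mul_le_mul (by linarith [H.measure_nonneg A])
        (Real.exp_le_exp.2 (neg_le_neg (mul_le_mul_of_nonneg_right hA hneg)))
        (Real.exp_pos _).le zero_le_one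
    have h5 : Real.exp (-(α * (g * τ t))) ≤ p * π x₀ := by
      rw [← Real.le_log_iff_exp_le (by positivity)]
      linarith
    have h6 : π x₀ * tail t A x ≤ π x₀ * p := by linarith
    exact le_of_mul_le_mul_left h6 hc
  · have h5 : 1 ≤ p * π x₀ := by
      have h6 : 0 < Real.log (p * π x₀) := by nlinarith
      exact ((Real.log_pos_iff (by positivity)).1 h6).le
    have h6 : π x₀ ≤ 1 := by
      rw [← H.π_sum]
      exact Finset.single_le_sum (fun y _ => (H.π_pos y).le) (Finset.mem_univ x₀)
    have h7 : 1 ≤ p := h5.trans (mul_le_of_le_one_right hp.le h6)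
    exact (H.tail_le_one t A x).trans h7

end HittingSystem

end FiniteChain

namespace FiniteChain

variable {Ω : Type*} [Fintype Ω] [DecidableEq Ω]

/-! ### Powers and Poissonized powers of nonnegative matrices -/

/-- The Poisson weights. -/
def poissonWeight (t : ℝ) (k : ℕ) : ℝ := Real.exp (-t) * t ^ k / (k.factorial : ℝ)

theorem poissonWeight_nonneg {t : ℝ} (ht : 0 ≤ t) (k : ℕ) : 0 ≤ poissonWeight t k := by
  unfold poissonWeight; positivity

/-- The multiplier of the continuous-time semigroup. -/
def heatMul (t l : ℝ) : ℝ := Real.exp (-(t * (1 - l)))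

theorem heatMul_pos (t l : ℝ) : 0 < heatMul t l := Real.exp_pos _

theorem heatMul_add (s t l : ℝ) : heatMul (s + t) l = heatMul s l * heatMul t l := by
  rw [heatMul, heatMul, heatMul, ← Real.exp_add]; ring_nf

theorem hasSum_poissonWeight_mul_pow (t l : ℝ) :
    HasSum (fun k => poissonWeight t k * l ^ k) (heatMul t l) := by
  have h := (NormedSpace.expSeries_div_hasSum_exp (t * l)).mul_left (Real.exp (-t))
  rw [← Real.exp_eq_exp_ℝ, ← Real.exp_add] at h
  have e1 : heatMul t l = Real.exp (-t + t * l) := by unfold heatMul; ring_nf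
  have e2 : (fun k => poissonWeight t k * l ^ k) =
      fun k : ℕ => Real.exp (-t) * ((t * l) ^ k / (k.factorial : ℝ)) := by
    funext k
    rw [poissonWeight, mul_pow]; ring
  rw [e1, e2]
  exact h

theorem hasSum_poissonWeight (t : ℝ) : HasSum (poissonWeight t) 1 := by
  simpa [heatMul] using hasSum_poissonWeight_mul_pow t 1

theorem EigenBasis.hasSum_fn_heatMul {π : Ω → ℝ} {K : Matrix Ω Ω ℝ} (E : EigenBasis π K)
    (t : ℝ) (f : Ω → ℝ) (x : Ω) :
    HasSum (fun k => poissonWeight t k * (K ^ k).mulVec f x) (E.fn (heatMul t) f x) := by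
  rw [E.fn_apply]
  have h : HasSum (fun k => ∑ i, poissonWeight t k * E.ev i ^ k * (ip π f (E.φ i) * E.φ i x))
      (∑ i, heatMul t (E.ev i) * (ip π f (E.φ i) * E.φ i x)) :=
    hasSum_sum fun i _ => (hasSum_poissonWeight_mul_pow t (E.ev i)).mul_right _
  convert h using 1
  · funext k
    rw [← E.fn_pow, E.fn_apply, Finset.mul_sum]
    exact Finset.sum_congr rfl fun i _ => by ring
  · exact Finset.sum_congr rfl fun i _ => by ring

theorem EigenBasis.hasDerivAt_fn_heatMul {π : Ω → ℝ} {K : Matrix Ω Ω ℝ} (E : EigenBasis π K)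
    (t : ℝ) (f : Ω → ℝ) (x : Ω) :
    HasDerivAt (fun r => E.fn (heatMul r) f x)
      (K.mulVec (E.fn (heatMul t) f) x - E.fn (heatMul t) f x) t := by
  rw [E.mulVec_fn]
  simp only [E.fn_apply]
  rw [← Finset.sum_sub_distrib]
  refine HasDerivAt.fun_sum fun i _ => ?_
  have h1 : HasDerivAt (fun r => heatMul r (E.ev i)) (heatMul t (E.ev i) * -(1 - E.ev i)) t := by
    have := ((hasDerivAt_id t).mul_const (1 - E.ev i)).fun_neg.exp
    simpa [heatMul] using this
  have h2 := (h1.mul_const (ip π f (E.φ i))).mul_const (E.φ i x)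
  exact h2.congr_deriv (by ring)

theorem mulVec_mono {Ω : Type*} [Fintype Ω] {A B : Matrix Ω Ω ℝ} (hA : ∀ x y, 0 ≤ A x y) (hAB : ∀ x y, A x y ≤ B x y)
    {f g : Ω → ℝ} (hg : ∀ x, 0 ≤ g x) (hfg : ∀ x, f x ≤ g x) (x : Ω) :
    A.mulVec f x ≤ B.mulVec g x :=
  Finset.sum_le_sum fun y _ => (mul_le_mul_of_nonneg_left (hfg y) (hA x y)).trans
    (mul_le_mul_of_nonneg_right (hAB x y) (hg y))

theorem mulVec_nonneg_of_nonneg {Ω : Type*} [Fintype Ω] {A : Matrix Ω Ω ℝ} (hA : ∀ x y, 0 ≤ A x y) {f : Ω → ℝ}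
    (hf : ∀ x, 0 ≤ f x) (x : Ω) : 0 ≤ A.mulVec f x :=
  Finset.sum_nonneg fun y _ => mul_nonneg (hA x y) (hf y)

theorem pow_mulVec_nonneg {A : Matrix Ω Ω ℝ} (hA : ∀ x y, 0 ≤ A x y) {f : Ω → ℝ}
    (hf : ∀ x, 0 ≤ f x) (n : ℕ) (x : Ω) : 0 ≤ (A ^ n).mulVec f x := by
  induction n generalizing x with
  | zero => simpa using hf x
  | succ n ih =>
    rw [pow_succ', ← Matrix.mulVec_mulVec]
    exact mulVec_nonneg_of_nonneg hA ih x

theorem pow_mulVec_mono {A B : Matrix Ω Ω ℝ} (hA : ∀ x y, 0 ≤ A x y)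
    (hAB : ∀ x y, A x y ≤ B x y) {f : Ω → ℝ} (hf : ∀ x, 0 ≤ f x) (n : ℕ) (x : Ω) :
    (A ^ n).mulVec f x ≤ (B ^ n).mulVec f x := by
  induction n generalizing x with
  | zero => simp
  | succ n ih =>
    rw [pow_succ', pow_succ', ← Matrix.mulVec_mulVec, ← Matrix.mulVec_mulVec]
    exact mulVec_mono hA hAB
      (pow_mulVec_nonneg (fun x y => (hA x y).trans (hAB x y)) hf n) ih x

/-! ### The spectrum of an irreducible reversible chain -/

section Spectrum

variable {P : Matrix.rowStochastic ℝ Ω} {π : Ω → ℝ}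

theorem mulVec_const_one (P : Matrix.rowStochastic ℝ Ω) : P.1.mulVec 1 = 1 :=
  Matrix.one_vecMul_of_mem_rowStochastic P.2

theorem pow_mulVec_one (P : Matrix.rowStochastic ℝ Ω) (n : ℕ) : (P.1 ^ n).mulVec 1 = 1 :=
  mulVec_const_one (P ^ n)

theorem pow_row_sum (P : Matrix.rowStochastic ℝ Ω) (n : ℕ) (x : Ω) : ∑ y, (P.1 ^ n) x y = 1 :=
  Matrix.sum_row_of_mem_rowStochastic (P ^ n).2 x

theorem pow_entry_nonneg (P : Matrix.rowStochastic ℝ Ω) (n : ℕ) (x y : Ω) : 0 ≤ (P.1 ^ n) x y :=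
  (P ^ n).2.1 x y

theorem IsStationary.pos (hstat : IsStationary P π) (hirr : P.1.IsIrreducible) (x : Ω) :
    0 < π x := by
  have h1 : ∑ x, π x = 1 := hstat.1.2
  obtain ⟨z, -, hz⟩ : ∃ z ∈ Finset.univ, 0 < π z :=
    Finset.exists_lt_of_sum_lt (f := fun _ => (0 : ℝ)) (by simp [h1])
  obtain ⟨k, -, hk⟩ := (Matrix.isIrreducible_iff_exists_pow_pos hirr.nonneg).1 hirr z x
  have h2 : Matrix.vecMul π (P.1 ^ k) = π := by
    clear hk
    induction k with
    | zero => simp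
    | succ n ih => rw [pow_succ, ← Matrix.vecMul_vecMul, ih, hstat.2]
  rw [← h2]
  exact (mul_pos hz hk).trans_le (Finset.single_le_sum (f := fun y => π y * (P.1 ^ k) y x)
    (fun y _ => mul_nonneg (hstat.1.1 y) (pow_entry_nonneg P k y x)) (Finset.mem_univ z))

/-- Gershgorin's argument, at a point where `|f|` is maximal. It yields both `l ≤ 1` and, for lazy
chains, `0 ≤ l`. -/
theorem exists_abs_eigenvalue_sub_le {f : Ω → ℝ} (hf : f ≠ 0) {l : ℝ}
    (h : P.1.mulVec f = l • f) : ∃ x, |l - P.1 x x| ≤ 1 - P.1 x x := by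
  obtain ⟨z, hz⟩ := Function.ne_iff.1 hf
  have : Nonempty Ω := ⟨z⟩
  obtain ⟨x, hx⟩ := Finite.exists_max fun y => |f y|
  have hx0 : 0 < |f x| := (abs_pos.2 hz).trans_le (hx z)
  refine ⟨x, le_of_mul_le_mul_right ?_ hx0⟩
  have h1 : l * f x = ∑ y, P.1 x y * f y := (congrFun h x).symm
  have h2 := Matrix.sum_row_of_mem_rowStochastic P.2 x
  rw [← Finset.add_sum_erase _ _ (Finset.mem_univ x)] at h1 h2
  rw [← abs_mul, show (l - P.1 x x) * f x = ∑ y ∈ Finset.univ.erase x, P.1 x y * f y by linarith,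
    show 1 - P.1 x x = ∑ y ∈ Finset.univ.erase x, P.1 x y by linarith, Finset.sum_mul]
  refine (Finset.abs_sum_le_sum_abs _ _).trans (Finset.sum_le_sum fun y _ => ?_)
  rw [abs_mul, abs_of_nonneg (P.2.1 x y)]
  exact mul_le_mul_of_nonneg_left (hx y) (P.2.1 x y)

theorem eigenvalue_le_one {f : Ω → ℝ} (hf : f ≠ 0) {l : ℝ} (h : P.1.mulVec f = l • f) :
    l ≤ 1 := by
  obtain ⟨x, hx⟩ := exists_abs_eigenvalue_sub_le hf h
  linarith [(abs_le.1 hx).2]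

theorem IsLazy.eigenvalue_nonneg (hl : IsLazy P) {f : Ω → ℝ} (hf : f ≠ 0) {l : ℝ}
    (h : P.1.mulVec f = l • f) : 0 ≤ l := by
  obtain ⟨x, hx⟩ := exists_abs_eigenvalue_sub_le hf h
  linarith [(abs_le.1 hx).1, hl x]

/-- Maximum principle: a harmonic function attaining its maximum at `z` takes the same value at
every point that can be reached from `z`. -/
theorem eq_of_mulVec_eq_self (hirr : P.1.IsIrreducible) {f : Ω → ℝ} (h : P.1.mulVec f = f)
    (x y : Ω) : f x = f y := by
  have : Nonempty Ω := ⟨x⟩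
  obtain ⟨z, hz⟩ := Finite.exists_max f
  suffices ∀ y, f y = f z by rw [this x, this y]
  intro y
  obtain ⟨k, -, hk⟩ := (Matrix.isIrreducible_iff_exists_pow_pos hirr.nonneg).1 hirr z y
  have h2 : (P.1 ^ k).mulVec f = f := by
    clear hk
    induction k with
    | zero => simp
    | succ n ih => rw [pow_succ, ← Matrix.mulVec_mulVec, h, ih]
  by_contra hne
  have hlt : f y < f z := lt_of_le_of_ne (hz y) hne
  have h3 : ∑ w, (P.1 ^ k) z w * f w < ∑ w, (P.1 ^ k) z w * f z :=
    Finset.sum_lt_sum (fun w _ => mul_le_mul_of_nonneg_left (hz w) (pow_entry_nonneg P k z w))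
      ⟨y, Finset.mem_univ y, mul_lt_mul_of_pos_left hlt hk⟩
  rw [← Finset.sum_mul, pow_row_sum, one_mul] at h3
  exact h3.ne (congrFun h2 z)

theorem hasEigenvalue_iff {K : Matrix Ω Ω ℝ} {l : ℝ} :
    Module.End.HasEigenvalue (Matrix.toLin' K) l ↔ ∃ f : Ω → ℝ, f ≠ 0 ∧ K.mulVec f = l • f := by
  constructor
  · intro h
    obtain ⟨f, hf⟩ := h.exists_hasEigenvector
    exact ⟨f, hf.2, by simpa using hf.apply_eq_smul⟩
  · rintro ⟨f, hf, h⟩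
    exact Module.End.hasEigenvalue_of_hasEigenvector (x := f)
      ⟨Module.End.mem_eigenspace_iff.2 (by simpa using h), hf⟩

theorem finite_eigenvalues_ne_one (P : Matrix.rowStochastic ℝ Ω) :
    {l : ℝ | l ≠ 1 ∧ Module.End.HasEigenvalue (Matrix.toLin' P.1) l}.Finite :=
  (Module.End.finite_hasEigenvalue (Matrix.toLin' P.1)).subset fun _ h => h.2

theorem le_secondEigenvalue {f : Ω → ℝ} (hf : f ≠ 0) {l : ℝ} (h : P.1.mulVec f = l • f)
    (hl : l ≠ 1) : l ≤ secondEigenvalue P :=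
  le_csSup (finite_eigenvalues_ne_one P).bddAbove ⟨hl, hasEigenvalue_iff.2 ⟨f, hf, h⟩⟩

theorem secondEigenvalue_eq_zero_or (P : Matrix.rowStochastic ℝ Ω) :
    secondEigenvalue P = 0 ∨ (secondEigenvalue P ≠ 1 ∧
      ∃ f : Ω → ℝ, f ≠ 0 ∧ P.1.mulVec f = secondEigenvalue P • f) := by
  rcases Set.eq_empty_or_nonempty
    {l : ℝ | l ≠ 1 ∧ Module.End.HasEigenvalue (Matrix.toLin' P.1) l} with h | h
  -- Here `sSup ∅ = 0`, the convention that makes the relaxation time of a one-point chain equal to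
  -- `1`.
  · left
    rw [secondEigenvalue, h, Real.sSup_empty]
  · right
    have := h.csSup_mem (finite_eigenvalues_ne_one P)
    exact ⟨this.1, hasEigenvalue_iff.1 this.2⟩

theorem secondEigenvalue_lt_one (P : Matrix.rowStochastic ℝ Ω) : secondEigenvalue P < 1 := by
  rcases secondEigenvalue_eq_zero_or P with h | ⟨h1, f, hf, h⟩
  · rw [h]; norm_num
  · exact lt_of_le_of_ne (eigenvalue_le_one hf h) h1

/-- The spectral gap. -/
def gap (P : Matrix.rowStochastic ℝ Ω) : ℝ := 1 - secondEigenvalue P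

theorem gap_pos (P : Matrix.rowStochastic ℝ Ω) : 0 < gap P :=
  sub_pos.2 (secondEigenvalue_lt_one P)

theorem relTime_eq_inv_gap (P : Matrix.rowStochastic ℝ Ω) : relTime P = (gap P)⁻¹ := rfl

theorem EigenBasis.φ_ne_zero {K : Matrix Ω Ω ℝ} (E : EigenBasis π K) (i : Ω) : E.φ i ≠ 0 := by
  intro h
  have := E.ortho i i
  rw [h] at this
  simp [ip] at this

theorem EigenBasis.ip_eq_zero_or_ev_le (E : EigenBasis π P.1) (hirr : P.1.IsIrreducible)
    {f : Ω → ℝ} (hf : ip π f 1 = 0) (i : Ω) :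
    ip π f (E.φ i) = 0 ∨ E.ev i ≤ 1 - gap P := by
  by_cases h : E.ev i = 1
  · left
    have h1 := eq_of_mulVec_eq_self hirr (f := E.φ i) (by rw [E.eig, h, one_smul])
    have h2 : E.φ i = E.φ i i • (1 : Ω → ℝ) := by
      funext x
      simpa using h1 x i
    rw [h2, ip_smul_right, hf, mul_zero]
  · right
    rw [gap, sub_sub_cancel]
    exact le_secondEigenvalue (E.φ_ne_zero i) (E.eig i) h

theorem EigenBasis.ip_fn_self_le (E : EigenBasis π P.1) (hirr : P.1.IsIrreducible)
    {q : ℝ → ℝ} {c : ℝ} (hq : ∀ i, E.ev i ≤ 1 - gap P → q (E.ev i) ^ 2 ≤ c) {f : Ω → ℝ}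
    (hf : ip π f 1 = 0) : ip π (E.fn q f) (E.fn q f) ≤ c * ip π f f := by
  rw [E.ip_eq_sum, E.ip_eq_sum f f, Finset.mul_sum]
  refine Finset.sum_le_sum fun i _ => ?_
  rw [E.ip_fn]
  rcases E.ip_eq_zero_or_ev_le hirr hf i with h | h
  · simp [h]
  · nlinarith [mul_le_mul_of_nonneg_right (hq i h) (mul_self_nonneg (ip π f (E.φ i)))]

theorem EigenBasis.ip_mulVec_le (E : EigenBasis π P.1) (hirr : P.1.IsIrreducible)
    {f : Ω → ℝ} (hf : ip π f 1 = 0) : ip π f (P.1.mulVec f) ≤ (1 - gap P) * ip π f f := by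
  have h1 := E.fn_pow 1 f
  rw [pow_one] at h1
  rw [← h1, E.ip_fn_right, E.ip_eq_sum f f, Finset.mul_sum]
  refine Finset.sum_le_sum fun i _ => ?_
  rcases E.ip_eq_zero_or_ev_le hirr hf i with h | h
  · simp [h]
  · nlinarith [mul_le_mul_of_nonneg_right h (mul_self_nonneg (ip π f (E.φ i)))]

end Spectrum

/-! ### The chain killed on a set -/

section Killed

variable {P : Matrix.rowStochastic ℝ Ω} {π : Ω → ℝ}

/-- The restriction of the transition matrix to the complement of `A`. -/
def killed (P : Matrix.rowStochastic ℝ Ω) (A : Finset Ω) : Matrix Ω Ω ℝ :=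
  Matrix.of fun x y => ind Aᶜ x * P.1 x y * ind Aᶜ y

theorem killed_nonneg (P : Matrix.rowStochastic ℝ Ω) (A : Finset Ω) (x y : Ω) :
    0 ≤ killed P A x y :=
  mul_nonneg (mul_nonneg (ind_nonneg _ _) (P.2.1 x y)) (ind_nonneg _ _)

theorem killed_le (P : Matrix.rowStochastic ℝ Ω) (A : Finset Ω) (x y : Ω) :
    killed P A x y ≤ P.1 x y := by
  have h := P.2.1 x y
  calc ind Aᶜ x * P.1 x y * ind Aᶜ y ≤ 1 * P.1 x y * 1 :=
        mul_le_mul (mul_le_mul_of_nonneg_right (ind_le_one _ _) h) (ind_le_one _ _)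
          (ind_nonneg _ _) (by linarith)
    _ = P.1 x y := by ring

theorem killed_reversible (hrev : IsReversible P π) (A : Finset Ω) (x y : Ω) :
    π x * killed P A x y = π y * killed P A y x := by
  simp only [killed, Matrix.of_apply]
  linear_combination (ind Aᶜ x * ind Aᶜ y) * hrev x y

theorem killed_mulVec (P : Matrix.rowStochastic ℝ Ω) (A : Finset Ω) (f : Ω → ℝ) :
    (killed P A).mulVec f = fun x => ind Aᶜ x * P.1.mulVec (fun y => ind Aᶜ y * f y) x := by
  funext x
  simp only [Matrix.mulVec, dotProduct, killed, Matrix.of_apply, Finset.mul_sum]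
  exact Finset.sum_congr rfl fun y _ => by ring

theorem ip_ind_mul (π : Ω → ℝ) (A : Finset Ω) (f g : Ω → ℝ) :
    ip π f (fun x => ind A x * g x) = ip π (fun x => ind A x * f x) g :=
  Finset.sum_congr rfl fun x _ => by ring

theorem ip_ind_ind (π : Ω → ℝ) (A : Finset Ω) : ip π (ind A) (ind A) = ∑ y ∈ A, π y := by
  rw [← sum_mul_ind A π, ip]
  exact Finset.sum_congr rfl fun y _ => by unfold ind; split_ifs <;> simp

theorem ind_compl_eq_zero {A : Finset Ω} {x : Ω} (hx : x ∈ A) : ind Aᶜ x = 0 := by simp [ind, hx]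

theorem ind_compl_eq_one {A : Finset Ω} {x : Ω} (hx : x ∉ A) : ind Aᶜ x = 1 := by simp [ind, hx]

theorem IsStationary.measure_compl (hstat : IsStationary P π) (A : Finset Ω) :
    ∑ y ∈ Aᶜ, π y = 1 - ∑ y ∈ A, π y := by
  have h : ∑ x, π x = 1 := hstat.1.2
  rw [← h, ← Finset.sum_add_sum_compl A]; ring

/-- The Poincaré inequality for the centred function `f - m`. Since `f` lives on `Aᶜ`,
Cauchy–Schwarz gives `m² ≤ π(Aᶜ)‖f‖²`, so the variance of `f` is at least `π(A)‖f‖²`. -/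
theorem EigenBasis.ip_mulVec_le_of_support (E : EigenBasis π P.1) (hstat : IsStationary P π)
    (hirr : P.1.IsIrreducible) (hrev : IsReversible P π) {A : Finset Ω} {f : Ω → ℝ}
    (hf : ∀ x, ind Aᶜ x * f x = f x) :
    ip π f (P.1.mulVec f) ≤ (1 - (∑ y ∈ A, π y) * gap P) * ip π f f := by
  set m := ip π f 1 with hm
  have h11 : ip π (1 : Ω → ℝ) 1 = 1 := by
    simpa [ip] using hstat.1.2
  have hg : ip π (f - m • 1) 1 = 0 := by
    rw [ip_sub_left, ip_smul_left, h11, ← hm]; ring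
  have h1 := E.ip_mulVec_le hirr hg
  have h2 : ip π (f - m • 1) (f - m • 1) = ip π f f - m ^ 2 := by
    rw [ip_comm, ip_sub_left π f, ip_smul_left, ip_comm π 1, hg, ip_comm, ip_sub_left,
      ip_smul_left, ip_comm π 1, ← hm]
    ring
  have h3 : ip π (f - m • 1) (P.1.mulVec (f - m • 1)) = ip π f (P.1.mulVec f) - m ^ 2 := by
    have hc : ip π f (P.1.mulVec 1) = m := by rw [mulVec_const_one]
    have hc' : ip π (P.1.mulVec f) 1 = m := by
      rw [ip_mulVec_comm hrev, mulVec_const_one]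
    rw [Matrix.mulVec_sub, Matrix.mulVec_smul, mulVec_const_one, ip_comm, ip_sub_left,
      ip_smul_left, ip_comm π 1, hg, ip_comm, ip_sub_left, ip_smul_left, ip_comm π 1, hc']
    ring
  rw [h2, h3] at h1
  have h4 : m ^ 2 ≤ ip π f f * (1 - ∑ y ∈ A, π y) := by
    have h5 : m = ip π f (ind Aᶜ) := by
      have h6 := ip_ind_mul π Aᶜ f 1
      simp only [hf] at h6
      simp only [Pi.one_apply, mul_one] at h6
      exact h6.symm
    rw [h5, ← hstat.measure_compl, ← ip_ind_ind]
    exact ip_sq_le hstat.1.1 _ _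
  nlinarith [gap_pos P]

theorem EigenBasis.killed_ev_le (E : EigenBasis π P.1) (hstat : IsStationary P π)
    (hirr : P.1.IsIrreducible) (hrev : IsReversible P π) {A : Finset Ω}
    (F : EigenBasis π (killed P A)) (j : Ω) :
    ip π (ind Aᶜ) (F.φ j) = 0 ∨ F.ev j ≤ 1 - (∑ y ∈ A, π y) * gap P := by
  set f : Ω → ℝ := fun x => ind Aᶜ x * F.φ j x with hf
  have hff : ∀ x, ind Aᶜ x * f x = f x := fun x => by
    simp only [hf]; rw [← mul_assoc, ind_mul_ind]
  have h1 := E.ip_mulVec_le_of_support hstat hirr hrev hff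
  have h2 : ip π f (P.1.mulVec f) = F.ev j := by
    have h3 : ip π (F.φ j) ((killed P A).mulVec (F.φ j)) = F.ev j := by
      rw [F.eig, ip_smul_right, F.ortho, if_pos rfl, mul_one]
    rwa [killed_mulVec, ip_ind_mul] at h3
  rw [h2] at h1
  -- An eigenfunction with nonzero eigenvalue is supported on `Aᶜ`. For the eigenvalue `0` it need
  -- not be, and then only its restriction to `Aᶜ` is used.
  by_cases h0 : F.ev j = 0
  · rw [h0] at h1 ⊢
    by_contra! hc
    have h4 : ip π f f ≤ 0 := by nlinarith
    have h5 := ip_sq_le hstat.1.1 (ind Aᶜ) f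
    have h6 := ip_self_nonneg hstat.1.1 (f := f)
    rw [le_antisymm h4 h6, mul_zero] at h5
    have h7 : ip π (ind Aᶜ) f = 0 := by nlinarith
    apply hc.1
    rw [← h7, hf, ip_ind_mul]
    simp only [ind_mul_ind]
  · right
    have h4 : f = F.φ j := by
      have h5 := F.eig j
      rw [killed_mulVec] at h5
      funext x
      have h6 := congrFun h5 x
      simp only [Pi.smul_apply, smul_eq_mul] at h6
      apply mul_left_cancel₀ h0
      rw [← h6]
      simp only [hf]
      rw [mul_left_comm, ← h6, ← mul_assoc, ind_mul_ind]
    rwa [h4, F.ortho, if_pos rfl, mul_one] at h1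

/-- `Pₓ[T_A > n]` as a power of the killed matrix -/
def killedTail (P : Matrix.rowStochastic ℝ Ω) (n : ℕ) (A : Finset Ω) : Ω → ℝ :=
  ((killed P A) ^ n).mulVec (ind Aᶜ)

theorem killedTail_succ (P : Matrix.rowStochastic ℝ Ω) (n : ℕ) (A : Finset Ω) (x : Ω) :
    killedTail P (n + 1) A x = ((killed P A)).mulVec (killedTail P n A) x := by
  rw [killedTail, pow_succ', ← Matrix.mulVec_mulVec]; rfl

theorem killedTail_of_mem (P : Matrix.rowStochastic ℝ Ω) (n : ℕ) {A : Finset Ω} {x : Ω}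
    (hx : x ∈ A) : killedTail P n A x = 0 := by
  cases n with
  | zero => simpa [killedTail] using ind_compl_eq_zero hx
  | succ n => simp only [killedTail_succ, killed_mulVec, ind_compl_eq_zero hx, zero_mul]

theorem killedTail_nonneg (P : Matrix.rowStochastic ℝ Ω) (n : ℕ) (A : Finset Ω) (x : Ω) :
    0 ≤ killedTail P n A x :=
  pow_mulVec_nonneg (killed_nonneg P A) (ind_nonneg _) n x

theorem killedTail_le (P : Matrix.rowStochastic ℝ Ω) (n : ℕ) (A : Finset Ω) (x : Ω) :
    killedTail P n A x ≤ (P.1 ^ n).mulVec (ind Aᶜ) x :=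
  pow_mulVec_mono (killed_nonneg P A) (killed_le P A) (ind_nonneg _) n x

theorem killedTail_le_one (P : Matrix.rowStochastic ℝ Ω) (n : ℕ) (A : Finset Ω) (x : Ω) :
    killedTail P n A x ≤ 1 := by
  refine (killedTail_le P n A x).trans ?_
  have h := mulVec_mono (pow_entry_nonneg P n) (fun x y => le_rfl) (g := 1)
    (fun _ => zero_le_one) (ind_le_one Aᶜ) x
  rwa [pow_mulVec_one] at h

theorem killed_mulVec_of_support (P : Matrix.rowStochastic ℝ Ω) {A : Finset Ω} {f : Ω → ℝ}
    (hf : ∀ x ∈ A, f x = 0) {x : Ω} (hx : x ∉ A) : (killed P A).mulVec f x = P.1.mulVec f x := by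
  rw [killed_mulVec]
  simp only [ind_compl_eq_one hx, one_mul]
  congr 1
  funext y
  by_cases hy : y ∈ A
  · rw [hf y hy, mul_zero]
  · rw [ind_compl_eq_one hy, one_mul]

/-- Spectral expansion of `⟨1_{Aᶜ}, q(K) 1_{Aᶜ}⟩` for the killed matrix `K`: eigenfunctions that
escape the eigenvalue bound are orthogonal to `1_{Aᶜ}`, and the remaining weights add up to `π(Aᶜ)`.
-/
theorem sum_mul_fn_le (hstat : IsStationary P π) (hirr : P.1.IsIrreducible)
    (hrev : IsReversible P π) (E : EigenBasis π P.1) {A : Finset Ω}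
    (F : EigenBasis π (killed P A)) {q : ℝ → ℝ} {c : ℝ}
    (hq : ∀ j, F.ev j ≤ 1 - (∑ y ∈ A, π y) * gap P → q (F.ev j) ≤ c)
    (h0 : ∀ x ∈ A, F.fn q (ind Aᶜ) x = 0) :
    ∑ x, π x * F.fn q (ind Aᶜ) x ≤ (1 - ∑ y ∈ A, π y) * c := by
  have h1 : ∑ x, π x * F.fn q (ind Aᶜ) x = ip π (ind Aᶜ) (F.fn q (ind Aᶜ)) := by
    refine Finset.sum_congr rfl fun x _ => ?_
    by_cases hx : x ∈ A
    · rw [h0 x hx]; simp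
    · rw [ind_compl_eq_one hx, mul_one]
  rw [h1, F.ip_fn_right, ← hstat.measure_compl, ← ip_ind_ind π Aᶜ, F.ip_eq_sum (ind Aᶜ) (ind Aᶜ),
    Finset.sum_mul]
  refine Finset.sum_le_sum fun j _ => ?_
  rcases E.killed_ev_le hstat hirr hrev F j with h | h
  · simp [h]
  · nlinarith [mul_le_mul_of_nonneg_right (hq j h) (mul_self_nonneg (ip π (ind Aᶜ) (F.φ j)))]

end Killed

/-! ### Discrete time -/

variable {P : Matrix.rowStochastic ℝ Ω} {π : Ω → ℝ}

/-- The killed matrix is the compression of `P` to functions on `Aᶜ`, so it inherits positive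
semidefiniteness. -/
theorem IsLazy.killed_eigenvalue_nonneg (hl : IsLazy P)
    (E : EigenBasis π P.1) {A : Finset Ω} (F : EigenBasis π (killed P A)) (j : Ω) :
    0 ≤ F.ev j := by
  have h3 : ip π (F.φ j) ((killed P A).mulVec (F.φ j)) = F.ev j := by
    rw [F.eig, ip_smul_right, F.ortho, if_pos rfl, mul_one]
  rw [← h3, killed_mulVec, ip_ind_mul]
  have h1 := E.fn_pow 1 (fun y => ind Aᶜ y * F.φ j y)
  rw [pow_one] at h1
  rw [← h1, E.ip_fn_right]
  refine Finset.sum_nonneg fun i _ => ?_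
  rw [pow_one, mul_assoc]
  exact mul_nonneg (hl.eigenvalue_nonneg (E.φ_ne_zero i) (E.eig i)) (mul_self_nonneg _)

theorem pow_le_exp_of_le {l r : ℝ} (hl : 0 ≤ l) (hlr : l ≤ 1 - r) (n : ℕ) :
    l ^ n ≤ Real.exp (-(r * n)) := by
  have h : l ≤ Real.exp (-r) := by linarith [Real.add_one_le_exp (-r)]
  calc l ^ n ≤ Real.exp (-r) ^ n := pow_le_pow_left₀ hl h n
    _ = Real.exp (-(r * n)) := by rw [← Real.exp_nat_mul]; ring_nf

theorem hittingSystem_nat (hl : IsLazy P) (hstat : IsStationary P π) (hirr : P.1.IsIrreducible)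
    (hrev : IsReversible P π) :
    HittingSystem π (gap P) (fun n : ℕ => (n : ℝ)) (fun n => P.1 ^ n)
      (fun n A => killedTail P n A) := by
  obtain ⟨E⟩ := exists_eigenBasis (hstat.pos hirr) hrev
  have hE0 : ∀ i, 0 ≤ E.ev i := fun i => hl.eigenvalue_nonneg (E.φ_ne_zero i) (E.eig i)
  have hE1 : ∀ i, E.ev i ≤ 1 := fun i => eigenvalue_le_one (E.φ_ne_zero i) (E.eig i)
  refine
    { π_pos := hstat.pos hirr
      π_sum := hstat.1.2
      gap_pos := gap_pos P
      unbounded := fun R => exists_nat_ge R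
      nonneg := pow_entry_nonneg P
      row_sum := pow_row_sum P
      add := fun s t => pow_add _ _ _
      maximal := fun B r f => ?_
      contraction := fun s f hf => ?_
      tail_nonneg := killedTail_nonneg P
      tail_le_one := killedTail_le_one P
      tail_le := killedTail_le P
      tail_add := fun s t A x => ?_
      tail_stat := fun s A => ?_
      strongMarkov := fun s G f c hf hc t => ?_ }
  · have := E.maximal (T := ℕ) hstat.1.1 (fun n x => x ^ n) (fun t i => pow_nonneg (hE0 i) t)
      (fun t i => pow_le_one₀ (hE0 i) (hE1 i))
      (fun i => pow_right_anti₀ (hE0 i) (hE1 i))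
      (fun t f hf x => by
        rw [E.fn_pow]
        exact pow_mulVec_nonneg P.2.1 hf t x) B r f
    simpa only [E.fn_pow] using this
  · simp only [← E.fn_pow]
    refine E.ip_fn_self_le hirr (fun i hi => ?_) hf
    rw [← pow_mul]
    refine (pow_le_exp_of_le (hE0 i) hi _).trans_eq ?_
    push_cast
    ring_nf
  · simp only [killedTail]
    rw [pow_add, ← Matrix.mulVec_mulVec]
    exact pow_mulVec_mono (killed_nonneg P A) (killed_le P A) (killedTail_nonneg P s A) t x
  · obtain ⟨F⟩ := exists_eigenBasis (hstat.pos hirr) (killed_reversible hrev A)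
    have h : ∀ x, killedTail P s A x = F.fn (fun x => x ^ s) (ind Aᶜ) x := fun x => by
      rw [F.fn_pow]; rfl
    simp only [h]
    refine sum_mul_fn_le hstat hirr hrev E F (fun j hj => ?_) fun x hx => by
      rw [← h, killedTail_of_mem P s hx]
    refine (pow_le_exp_of_le (hl.killed_eigenvalue_nonneg E F j) hj _).trans_eq ?_
    rw [mul_assoc]
  -- First-step analysis: on `G` the bound is the hypothesis with `r = t`; off `G` the tail and the
  -- semigroup both advance by one step of `P`.
  · induction t with
    | zero =>
      intro x
      by_cases hx : x ∈ G
      · rw [killedTail_of_mem P 0 hx, sub_zero, mul_one]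
        exact hc 0 x hx
      · have : killedTail P 0 G x = 1 := by simpa [killedTail] using ind_compl_eq_one hx
        rw [this, sub_self, mul_zero]
        exact pow_mulVec_nonneg P.2.1 hf _ x
    | succ n ih =>
      intro x
      by_cases hx : x ∈ G
      · rw [killedTail_of_mem P _ hx, sub_zero, mul_one]
        exact hc _ x hx
      · rw [killedTail_succ, killed_mulVec_of_support P (fun y hy => killedTail_of_mem P n hy) hx,
          show n + 1 + s = (n + s) + 1 by ring, pow_succ', ← Matrix.mulVec_mulVec]
        have h1 : c * (1 - P.1.mulVec (killedTail P n G) x) =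
            P.1.mulVec (c • (1 - killedTail P n G)) x := by
          rw [Matrix.mulVec_smul, Matrix.mulVec_sub, mulVec_const_one]; rfl
        rw [h1]
        exact Finset.sum_le_sum fun y _ => mul_le_mul_of_nonneg_left (ih y) (P.2.1 x y)

end FiniteChain

namespace FiniteChain

variable {Ω : Type*} [Fintype Ω] [DecidableEq Ω]

/-! ### Continuous time -/

variable {P : Matrix.rowStochastic ℝ Ω} {π : Ω → ℝ}

/-- Parabolic minimum principle for the heat equation off `G`; it replaces the strong Markov
property in continuous time. If the minimum `m` over space and `[0, t]` were negative, it would be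
attained at a point `x₀` off `G`. There `e^r (z_r(x₀) - m)` is nondecreasing, nonnegative and
eventually zero, so `z` would already be negative at time `0`. -/
theorem minimum_principle (P : Matrix.rowStochastic ℝ Ω) (G : Finset Ω) {z : ℝ → Ω → ℝ}
    (hcont : ∀ x, Continuous fun r => z r x)
    (hG : ∀ r, 0 ≤ r → ∀ x ∈ G, 0 ≤ z r x) (h0 : ∀ x, x ∉ G → 0 ≤ z 0 x)
    (hderiv : ∀ r, 0 ≤ r → ∀ x, x ∉ G →
      HasDerivAt (fun r => z r x) (P.1.mulVec (z r) x - z r x) r)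
    {t : ℝ} (ht : 0 ≤ t) (x : Ω) : 0 ≤ z t x := by
  have : Nonempty Ω := ⟨x⟩
  have hmin : ∀ y, ∃ r ∈ Set.Icc 0 t, ∀ r' ∈ Set.Icc 0 t, z r y ≤ z r' y := fun y => by
    obtain ⟨r, hr, h⟩ := isCompact_Icc.exists_isMinOn (Set.nonempty_Icc.2 ht)
      (hcont y).continuousOn
    exact ⟨r, hr, fun r' hr' => h hr'⟩
  choose ρ hρ hρmin using hmin
  obtain ⟨x₀, hx₀⟩ := Finite.exists_min fun y => z (ρ y) y
  set m := z (ρ x₀) x₀ with hm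
  have hmle : ∀ r ∈ Set.Icc 0 t, ∀ y, m ≤ z r y := fun r hr y => (hx₀ y).trans (hρmin y r hr)
  suffices 0 ≤ m from this.trans (hmle t ⟨ht, le_rfl⟩ x)
  by_contra! hneg
  by_cases hxG : x₀ ∈ G
  · exact absurd (hG _ (hρ x₀).1 x₀ hxG) (not_le.2 hneg)
  have hd : ∀ r, 0 ≤ r → HasDerivAt (fun r => Real.exp r * (z r x₀ - m))
      (Real.exp r * (P.1.mulVec (z r) x₀ - m)) r := fun r hr =>
    ((Real.hasDerivAt_exp r).mul ((hderiv r hr x₀ hxG).sub_const m)).congr_deriv (by ring)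
  have hmono : MonotoneOn (fun r => Real.exp r * (z r x₀ - m)) (Set.Icc 0 t) := by
    refine monotoneOn_of_deriv_nonneg (convex_Icc 0 t)
      (Real.continuous_exp.mul ((hcont x₀).sub continuous_const)).continuousOn
      (fun r hr => ?_) fun r hr => ?_
    · rw [interior_Icc] at hr
      exact (hd r hr.1.le).differentiableAt.differentiableWithinAt
    · rw [interior_Icc] at hr
      rw [(hd r hr.1.le).deriv]
      refine mul_nonneg (Real.exp_pos _).le (sub_nonneg.2 ?_)
      have h1 : P.1.mulVec (m • 1) x₀ ≤ P.1.mulVec (z r) x₀ :=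
        Finset.sum_le_sum fun y _ => mul_le_mul_of_nonneg_left
          (by simpa using hmle r ⟨hr.1.le, hr.2.le⟩ y) (P.2.1 x₀ y)
      rw [Matrix.mulVec_smul, mulVec_const_one] at h1
      simpa using h1
  have h1 := hmono (Set.left_mem_Icc.2 ht) (hρ x₀) (hρ x₀).1
  simp only [← hm, sub_self, mul_zero, Real.exp_zero, one_mul] at h1
  linarith [h0 x₀ hxG]

/-- The heat kernel as a matrix -/
def heatMatrix (P : Matrix.rowStochastic ℝ Ω) (t : ℝ≥0) : Matrix Ω Ω ℝ :=
  Matrix.of fun x y => heatKernel P t x y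

/-- `Pₓ[T_A > t]` for the continuous-time chain, as a Poisson mixture of the discrete tails -/
def killedTailCt (P : Matrix.rowStochastic ℝ Ω) (t : ℝ≥0) (A : Finset Ω) (x : Ω) : ℝ :=
  ∑' k, poissonWeight t k * killedTail P k A x

/-- Identifies the Poisson series with the multiplier `e^{-t(1-λ)}`, so that semigroup identities
reduce to scalar ones. -/
theorem heatMatrix_mulVec (E : EigenBasis π P.1) (t : ℝ≥0) (f : Ω → ℝ) :
    (heatMatrix P t).mulVec f = E.fn (heatMul t) f := by
  have h : ∀ x y, heatKernel P t x y = E.fn (heatMul t) (Pi.single y 1) x := fun x y => by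
    rw [← (E.hasSum_fn_heatMul t (Pi.single y 1) x).tsum_eq]
    simp [heatKernel, poissonWeight]
  have hf : f = ∑ y, f y • (Pi.single y 1 : Ω → ℝ) := by
    funext x
    simp [Finset.sum_apply, Pi.single_apply]
  have hsum : E.fn (heatMul t) f = ∑ y, f y • E.fn (heatMul t) (Pi.single y 1) := by
    have h2 : ∀ s : Finset Ω, E.fn (heatMul t) (∑ y ∈ s, f y • (Pi.single y 1 : Ω → ℝ)) =
        ∑ y ∈ s, f y • E.fn (heatMul t) (Pi.single y 1) := by
      intro s
      induction s using Finset.induction_on with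
      | empty => simpa using E.fn_smul (heatMul t) 0 0
      | insert a s ha ih => rw [Finset.sum_insert ha, Finset.sum_insert ha, E.fn_add, ih, E.fn_smul]
    conv_lhs => rw [hf]
    exact h2 _
  rw [hsum]
  funext x
  simp only [Matrix.mulVec, dotProduct, heatMatrix, Matrix.of_apply, h, Finset.sum_apply,
    Pi.smul_apply, smul_eq_mul]
  exact Finset.sum_congr rfl fun y _ => mul_comm _ _

theorem fn_heatMul_nonneg {K : Matrix Ω Ω ℝ} (E : EigenBasis π K) (hK : ∀ x y, 0 ≤ K x y)
    (t : ℝ≥0) {f : Ω → ℝ} (hf : ∀ x, 0 ≤ f x) (x : Ω) : 0 ≤ E.fn (heatMul t) f x :=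
  (E.hasSum_fn_heatMul t f x).nonneg fun k =>
    mul_nonneg (poissonWeight_nonneg t.2 k) (pow_mulVec_nonneg hK hf k x)

theorem fn_heatMul_mono {K L : Matrix Ω Ω ℝ} (E : EigenBasis π K) (F : EigenBasis π L)
    (hK : ∀ x y, 0 ≤ K x y) (hKL : ∀ x y, K x y ≤ L x y)
    (t : ℝ≥0) {f : Ω → ℝ} (hf : ∀ x, 0 ≤ f x) (x : Ω) :
    E.fn (heatMul t) f x ≤ F.fn (heatMul t) f x :=
  hasSum_le (fun k => mul_le_mul_of_nonneg_left (pow_mulVec_mono hK hKL hf k x)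
    (poissonWeight_nonneg t.2 k)) (E.hasSum_fn_heatMul t f x) (F.hasSum_fn_heatMul t f x)

theorem killedTailCt_eq {A : Finset Ω} (F : EigenBasis π (killed P A)) (t : ℝ≥0) (x : Ω) :
    killedTailCt P t A x = F.fn (heatMul t) (ind Aᶜ) x :=
  (F.hasSum_fn_heatMul t (ind Aᶜ) x).tsum_eq

theorem killedTailCt_of_mem (P : Matrix.rowStochastic ℝ Ω) (t : ℝ≥0) {A : Finset Ω} {x : Ω}
    (hx : x ∈ A) : killedTailCt P t A x = 0 := by
  simp [killedTailCt, killedTail_of_mem P _ hx]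

theorem hittingSystem_nnreal (hstat : IsStationary P π) (hirr : P.1.IsIrreducible)
    (hrev : IsReversible P π) :
    HittingSystem π (gap P) (fun t : ℝ≥0 => (t : ℝ)) (heatMatrix P)
      (fun t A => killedTailCt P t A) := by
  obtain ⟨E⟩ := exists_eigenBasis (hstat.pos hirr) hrev
  have hF := fun A => exists_eigenBasis (hstat.pos hirr) (killed_reversible hrev A)
  have hE1 : ∀ i, E.ev i ≤ 1 := fun i => eigenvalue_le_one (E.φ_ne_zero i) (E.eig i)
  have hM1 : ∀ t, (heatMatrix P t).mulVec 1 = 1 := fun t => by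
    rw [heatMatrix_mulVec E, E.fn_eq_of_mulVec (l := 1) (by rw [mulVec_const_one, one_smul])]
    simp [heatMul]
  have htail0 : ∀ t A x, 0 ≤ killedTailCt P t A x := fun t A x => by
    obtain ⟨F⟩ := hF A
    rw [killedTailCt_eq F]
    exact fn_heatMul_nonneg F (killed_nonneg P A) t (ind_nonneg _) x
  have htail : ∀ t A x, killedTailCt P t A x ≤ (heatMatrix P t).mulVec (ind Aᶜ) x := fun t A x => by
    obtain ⟨F⟩ := hF A
    rw [killedTailCt_eq F, heatMatrix_mulVec E]
    exact fn_heatMul_mono F E (killed_nonneg P A) (killed_le P A) t (ind_nonneg _) x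
  have hM0 : ∀ t x y, 0 ≤ heatMatrix P t x y := fun t x y =>
    tsum_nonneg fun k => mul_nonneg (poissonWeight_nonneg t.2 k) (pow_entry_nonneg P k x y)
  refine
    { π_pos := hstat.pos hirr
      π_sum := hstat.1.2
      gap_pos := gap_pos P
      unbounded := fun R => ⟨R.toNNReal, Real.le_coe_toNNReal R⟩
      nonneg := hM0
      row_sum := fun t x => ?_
      add := fun s t => ?_
      maximal := fun B r f => ?_
      contraction := fun s f hf => ?_
      tail_nonneg := htail0
      tail_le_one := fun t A x => ?_
      tail_le := htail
      tail_add := fun s t A x => ?_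
      tail_stat := fun s A => ?_
      strongMarkov := fun s G f c hf hc t x => ?_ }
  · have := congrFun (hM1 t) x
    simpa [Matrix.mulVec, dotProduct] using this
  · refine Matrix.ext_of_mulVec_single fun y => ?_
    rw [← Matrix.mulVec_mulVec]
    simp only [heatMatrix_mulVec E, E.fn_fn]
    congr 1
    funext l
    push_cast
    rw [heatMul_add]
  · have := E.maximal (T := ℝ≥0) hstat.1.1 (fun t => heatMul t) (fun t i => (heatMul_pos _ _).le)
      (fun t i => by
        rw [heatMul, Real.exp_le_one_iff]
        exact neg_nonpos.2 (mul_nonneg t.2 (sub_nonneg.2 (hE1 i))))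
      (fun i s t hst => Real.exp_le_exp.2 (neg_le_neg
        (mul_le_mul_of_nonneg_right (NNReal.coe_le_coe.2 hst) (sub_nonneg.2 (hE1 i)))))
      (fun t f hf x => fn_heatMul_nonneg E P.2.1 t hf x) B r f
    simpa only [heatMatrix_mulVec E] using this
  · simp only [heatMatrix_mulVec E]
    refine E.ip_fn_self_le hirr (fun i hi => ?_) hf
    rw [heatMul, pow_two, ← Real.exp_add, Real.exp_le_exp]
    nlinarith [mul_le_mul_of_nonneg_left hi s.2]
  · refine (htail t A x).trans ?_
    have h := mulVec_mono (hM0 t) (fun x y => le_rfl) (g := 1)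
      (fun _ => zero_le_one) (ind_le_one Aᶜ) x
    rwa [hM1] at h
  · obtain ⟨F⟩ := hF A
    have h1 : killedTailCt P s A = F.fn (heatMul s) (ind Aᶜ) := funext (killedTailCt_eq F s)
    have h2 : killedTailCt P (t + s) A x = F.fn (heatMul t) (killedTailCt P s A) x := by
      rw [killedTailCt_eq F, h1, F.fn_fn]
      congr 1
      funext l
      push_cast
      rw [heatMul_add]
    rw [h2, heatMatrix_mulVec E]
    exact fn_heatMul_mono F E (killed_nonneg P A) (killed_le P A) t (htail0 s A) x
  · obtain ⟨F⟩ := hF A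
    simp only [killedTailCt_eq F]
    refine sum_mul_fn_le hstat hirr hrev E F (fun j hj => ?_) fun x hx => by
      rw [← killedTailCt_eq F, killedTailCt_of_mem P s hx]
    rw [heatMul, Real.exp_le_exp]
    nlinarith [mul_le_mul_of_nonneg_left hj s.2]
  · obtain ⟨F⟩ := hF G
    -- Off `G`, both `w` and `1 - u` solve the heat equation of `P`, since `u` vanishes on `G`. The
    -- minimum principle is applied to `w - c(1 - u)`.
    let w : ℝ → Ω → ℝ := fun r => E.fn (heatMul r) (E.fn (heatMul s) f)
    let u : ℝ → Ω → ℝ := fun r => F.fn (heatMul r) (ind Gᶜ)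
    have hw : ∀ r : ℝ≥0, ∀ y, w r y = (heatMatrix P (r + s)).mulVec f y := fun r y => by
      simp only [w]
      rw [heatMatrix_mulVec E, E.fn_fn]
      congr 1
      funext l
      push_cast
      rw [heatMul_add]
    have hu : ∀ r : ℝ≥0, ∀ y, u r y = killedTailCt P r G y := fun r y =>
      (killedTailCt_eq F r y).symm
    have hu0 : ∀ r, 0 ≤ r → ∀ y ∈ G, u r y = 0 := fun r hr y hy =>
      (hu ⟨r, hr⟩ y).trans (killedTailCt_of_mem P _ hy)
    have hd : ∀ r y, HasDerivAt (fun r => w r y - c * (1 - u r y))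
        ((P.1.mulVec (w r) y - w r y) + c * ((killed P G).mulVec (u r) y - u r y)) r :=
      fun r y => ((E.hasDerivAt_fn_heatMul r _ y).sub
        (((F.hasDerivAt_fn_heatMul r _ y).const_sub 1).const_mul c)).congr_deriv (by ring)
    have key := minimum_principle P G (z := fun r y => w r y - c * (1 - u r y))
      (fun y => continuous_iff_continuousAt.2 fun r => (hd r y).continuousAt)
      (fun r hr y hy => by
        rw [hu0 r hr y hy, sub_zero, mul_one, sub_nonneg]
        exact (hc ⟨r, hr⟩ y hy).trans_eq (hw ⟨r, hr⟩ y).symm)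
      (fun y hy => by
        have h1 : u 0 y = 1 := by
          have : heatMul 0 = fun _ => 1 := by funext l; simp [heatMul]
          simp only [u, this, F.fn_one, ind_compl_eq_one hy]
        rw [h1, sub_self, mul_zero, sub_zero]
        have := hw 0 y
        rw [NNReal.coe_zero] at this
        rw [this]
        exact mulVec_nonneg_of_nonneg (hM0 _) hf y)
      (fun r hr y hy => (hd r y).congr_deriv (by
        rw [killed_mulVec_of_support P (hu0 r hr) hy]
        have : (fun y => w r y - c * (1 - u r y)) = w r - c • (1 - u r) := by
          funext y; simp
        rw [this, Matrix.mulVec_sub, Matrix.mulVec_smul, Matrix.mulVec_sub, mulVec_const_one]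
        simp only [Pi.sub_apply, Pi.smul_apply, Pi.one_apply, smul_eq_mul]
        ring))
      t.2 x
    have h1 := hw t x
    have h2 := hu t x
    simp only [NNReal.val_eq_coe] at key
    rw [h1, h2] at key
    linarith

end FiniteChain

namespace FiniteChain

/-! ### The hitting probabilities of the discrete-time chain -/

variable {Ω : Type*} [Fintype Ω] [DecidableEq Ω]

/-- The indicator of avoiding `A` along a finite trajectory -/
def avoids (A : Finset Ω) (n : ℕ) (h : ∀ _ : Finset.Iic n, Ω) : ℝ≥0∞ :=
  ∏ i : Finset.Iic n, ENNReal.ofReal (ind Aᶜ (h i))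

theorem avoids_frestrictLe (A : Finset Ω) (n : ℕ) (ω : ℕ → Ω) :
    avoids A n (Preorder.frestrictLe (π := fun _ => Ω) n ω) =
      ∏ i ∈ Finset.Iic n, ENNReal.ofReal (ind Aᶜ (ω i)) := by
  rw [← Finset.prod_coe_sort]
  rfl

theorem avoids_succ (A : Finset Ω) (n : ℕ) (ω : ℕ → Ω) :
    avoids A (n + 1) (Preorder.frestrictLe (π := fun _ => Ω) (n + 1) ω) =
      avoids A n (Preorder.frestrictLe (π := fun _ => Ω) n ω) *
        ENNReal.ofReal (ind Aᶜ (ω (n + 1))) := by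
  rw [avoids_frestrictLe, avoids_frestrictLe, ← Nat.range_succ_eq_Iic, ← Nat.range_succ_eq_Iic,
    Finset.prod_range_succ]

variable [MeasurableSpace Ω] [MeasurableSingletonClass Ω]

theorem lintegral_stepKernel (P : Matrix.rowStochastic ℝ Ω) (x : Ω) {f : Ω → ℝ}
    (hf : ∀ y, 0 ≤ f y) :
    ∫⁻ y, ENNReal.ofReal (f y) ∂(stepKernel P x) = ENNReal.ofReal (P.1.mulVec f x) := by
  change ∫⁻ y, ENNReal.ofReal (f y) ∂(∑ y, ENNReal.ofReal (P.1 x y) • Measure.dirac y) = _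
  rw [lintegral_finsetSum_measure, Matrix.mulVec, dotProduct,
    ENNReal.ofReal_sum_of_nonneg fun y _ => mul_nonneg (P.2.1 x y) (hf y)]
  refine Finset.sum_congr rfl fun y _ => ?_
  rw [lintegral_smul_measure, lintegral_dirac, smul_eq_mul, ENNReal.ofReal_mul (P.2.1 x y)]

instance isProbabilityMeasure_chainLaw (P : Matrix.rowStochastic ℝ Ω) (x : Ω) :
    IsProbabilityMeasure (chainLaw P x) := by
  unfold chainLaw; infer_instance

theorem measurable_avoids (A : Finset Ω) (n : ℕ) : Measurable (avoids A n) :=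
  Finset.measurable_prod _ fun i _ =>
    (Measurable.of_discrete (f := fun y => ENNReal.ofReal (ind Aᶜ y))).comp (measurable_pi_apply i)

/-- The test function `f` of the last state is what makes the induction close: integrating out the
last step replaces `f` by `P(1_{Aᶜ} f)` one step earlier. -/
theorem lintegral_avoids (P : Matrix.rowStochastic ℝ Ω) (x : Ω) (A : Finset Ω) (n : ℕ)
    {f : Ω → ℝ} (hf : ∀ y, 0 ≤ f y) :
    ∫⁻ ω, avoids A n (Preorder.frestrictLe (π := fun _ => Ω) n ω) * ENNReal.ofReal (f (ω n))
      ∂(chainLaw P x) =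
      ENNReal.ofReal (((killed P A) ^ n).mulVec (fun y => ind Aᶜ y * f y) x) := by
  have hmeas : ∀ g : Ω → ℝ, Measurable fun y => ENNReal.ofReal (g y) :=
    fun g => Measurable.of_discrete
  induction n generalizing f with
  | zero =>
    have hm : Measurable fun h : (∀ _ : Finset.Iic 0, Ω) =>
        avoids A 0 h * ENNReal.ofReal (f (h ⟨0, Finset.mem_Iic.2 le_rfl⟩)) :=
      (measurable_avoids A 0).mul ((hmeas f).comp (measurable_pi_apply _))
    have h1 := lintegral_map (μ := chainLaw P x) hm
      (Preorder.measurable_frestrictLe (X := fun _ => Ω) 0)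
    rw [chainLaw, Kernel.traj_map_frestrictLe_apply, Kernel.partialTraj_self, Kernel.id_apply,
      lintegral_dirac' _ hm] at h1
    refine h1.symm.trans ?_
    simp only [pow_zero, Matrix.one_mulVec]
    rw [ENNReal.ofReal_mul (ind_nonneg _ _)]
    congr 1
    simp [avoids]
  | succ n ih =>
    let κ : (n : ℕ) → Kernel (∀ _ : Finset.Iic n, Ω) Ω := fun n => (stepKernel P).comap
      (fun h : (∀ _ : Finset.Iic n, Ω) => h ⟨n, Finset.mem_Iic.2 le_rfl⟩)
      (measurable_pi_apply _)
    let F : (∀ _ : Finset.Iic n, Ω) × Ω → ℝ≥0∞ := fun p =>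
      avoids A n p.1 * ENNReal.ofReal (ind Aᶜ p.2 * f p.2)
    have hF : Measurable F := ((measurable_avoids A n).comp measurable_fst).mul
      ((hmeas fun y => ind Aᶜ y * f y).comp measurable_snd)
    have hg : ∀ y, 0 ≤ ind Aᶜ y * f y := fun y => mul_nonneg (ind_nonneg _ y) (hf y)
    have hPg : ∀ y, 0 ≤ P.1.mulVec (fun y => ind Aᶜ y * f y) y :=
      mulVec_nonneg_of_nonneg P.2.1 hg
    have e1 : ∀ ω : ℕ → Ω, avoids A (n + 1) (Preorder.frestrictLe (π := fun _ => Ω) (n + 1) ω) *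
        ENNReal.ofReal (f (ω (n + 1))) =
        F (Preorder.frestrictLe (π := fun _ => Ω) n ω, ω (n + 1)) := fun ω => by
      simp only [F]
      rw [avoids_succ, ENNReal.ofReal_mul (ind_nonneg _ _), mul_assoc]
    have e2 := Kernel.partialTraj_compProd_eq_map_traj (X := fun _ => Ω) (κ := κ) (Nat.zero_le n)
      (x₀ := fun _ => x)
    have hm2 : Measurable fun ω : ℕ → Ω =>
        (Preorder.frestrictLe (π := fun _ => Ω) n ω, ω (n + 1)) :=
      (Preorder.measurable_frestrictLe (X := fun _ => Ω) n).prodMk (measurable_pi_apply _)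
    have hm3 : Measurable fun h : (∀ _ : Finset.Iic n, Ω) => avoids A n h *
        ENNReal.ofReal (P.1.mulVec (fun y => ind Aᶜ y * f y) (h ⟨n, Finset.mem_Iic.2 le_rfl⟩)) :=
      (measurable_avoids A n).mul ((hmeas _).comp (measurable_pi_apply _))
    have hκ : ∀ h, ∫⁻ y, F (h, y) ∂(κ n h) = avoids A n h *
        ENNReal.ofReal (P.1.mulVec (fun y => ind Aᶜ y * f y) (h ⟨n, Finset.mem_Iic.2 le_rfl⟩)) := by
      intro h
      simp only [F]
      rw [lintegral_const_mul _ (hmeas _), ← lintegral_stepKernel P _ hg]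
      rfl
    calc _ = ∫⁻ ω, F (Preorder.frestrictLe (π := fun _ => Ω) n ω, ω (n + 1)) ∂(chainLaw P x) :=
          lintegral_congr e1
      _ = ∫⁻ p, F p ∂((Kernel.partialTraj (X := fun _ => Ω) κ 0 n (fun _ => x)).compProd (κ n)) := by
          rw [e2, lintegral_map hF hm2]; rfl
      _ = ∫⁻ h, avoids A n h * ENNReal.ofReal (P.1.mulVec (fun y => ind Aᶜ y * f y)
            (h ⟨n, Finset.mem_Iic.2 le_rfl⟩))
            ∂(Kernel.partialTraj (X := fun _ => Ω) κ 0 n (fun _ => x)) := by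
          rw [Measure.lintegral_compProd hF]
          exact lintegral_congr hκ
      _ = ∫⁻ ω, avoids A n (Preorder.frestrictLe (π := fun _ => Ω) n ω) *
            ENNReal.ofReal (P.1.mulVec (fun y => ind Aᶜ y * f y) (ω n)) ∂(chainLaw P x) := by
          rw [← Kernel.traj_map_frestrictLe_apply, lintegral_map hm3
            (Preorder.measurable_frestrictLe (X := fun _ => Ω) n)]
          rfl
      _ = _ := by
          rw [ih hPg, pow_succ, ← Matrix.mulVec_mulVec, killed_mulVec]
          congr 3
          funext y
          congr 2
          funext z
          rw [← mul_assoc, ind_mul_ind]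

theorem measurableSet_avoid {Ω : Type*} [MeasurableSpace Ω] [MeasurableSingletonClass Ω] (A : Finset Ω) (n : ℕ) :
    MeasurableSet {ω : ℕ → Ω | ∀ j ≤ n, ω j ∉ A} := by
  have : {ω : ℕ → Ω | ∀ j ≤ n, ω j ∉ A} = ⋂ j, ⋂ (_ : j ≤ n), (fun ω => ω j) ⁻¹' (A : Set Ω)ᶜ := by
    ext ω; simp
  rw [this]
  exact MeasurableSet.iInter fun j => MeasurableSet.iInter fun _ =>
    measurable_pi_apply j A.finite_toSet.measurableSet.compl

theorem chainLaw_avoid (P : Matrix.rowStochastic ℝ Ω) (x : Ω) (A : Finset Ω) (n : ℕ) :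
    chainLaw P x {ω | ∀ j ≤ n, ω j ∉ A} = ENNReal.ofReal (killedTail P n A x) := by
  have h := lintegral_avoids P x A n (f := 1) fun _ => zero_le_one
  simp only [Pi.one_apply, mul_one, ENNReal.ofReal_one] at h
  rw [killedTail, ← h, ← lintegral_indicator_one (measurableSet_avoid A n)]
  refine lintegral_congr fun ω => ?_
  rw [avoids_frestrictLe]
  by_cases hω : ∀ j ≤ n, ω j ∉ A
  · rw [Set.indicator_of_mem (by exact hω), Finset.prod_eq_one fun i hi => ?_]
    · rfl
    · rw [ind_compl_eq_one (hω i (Finset.mem_Iic.1 hi)), ENNReal.ofReal_one]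
  · rw [Set.indicator_of_notMem (by exact hω)]
    push Not at hω
    obtain ⟨j, hj, hjA⟩ := hω
    rw [Finset.prod_eq_zero (Finset.mem_Iic.2 hj)]
    rw [ind_compl_eq_zero hjA, ENNReal.ofReal_zero]

theorem chainLaw_lt_hittingAfter (P : Matrix.rowStochastic ℝ Ω) (x : Ω) (A : Finset Ω) (n : ℕ) :
    (chainLaw P x).real {ω | (n : WithTop ℕ) < hittingAfter process (A : Set Ω) 0 ω} =
      killedTail P n A x := by
  have h : {ω : ℕ → Ω | (n : WithTop ℕ) < hittingAfter process (A : Set Ω) 0 ω} =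
      {ω | ∀ j ≤ n, ω j ∉ A} := by
    ext ω
    have := hittingAfter_le_iff (u := process) (s := (A : Set Ω)) (n := 0) (i := n) (ω := ω)
    exact (not_le.symm.trans (not_congr this)).trans (by simp [process])
  rw [h, measureReal_def, chainLaw_avoid, ENNReal.toReal_ofReal (killedTail_nonneg P n A x)]

end FiniteChain

namespace FiniteChain

/-! ### The Poisson process of the holding times -/

/-- The law of the holding times -/
def holdingLaw : Measure (ℕ → ℝ) := Measure.infinitePi fun _ : ℕ => expMeasure 1

instance isProbabilityMeasure_expMeasure_one : IsProbabilityMeasure (expMeasure 1) :=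
  isProbabilityMeasure_expMeasure one_pos

instance isProbabilityMeasure_holdingLaw : IsProbabilityMeasure holdingLaw := by
  unfold holdingLaw; infer_instance

/-- The time of the `k`-th jump -/
def jumpTime (τ : ℕ → ℝ) (k : ℕ) : ℝ := ∑ i ∈ Finset.range k, τ i

theorem jumpTime_succ (τ : ℕ → ℝ) (k : ℕ) : jumpTime τ (k + 1) = jumpTime τ k + τ k :=
  Finset.sum_range_succ _ _

theorem measurable_jumpTime (k : ℕ) : Measurable fun τ => jumpTime τ k :=
  Finset.measurable_sum _ fun i _ => measurable_pi_apply i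

/-- The distribution function of the `k`-th jump time -/
def jumpCdf (k : ℕ) (t : ℝ) : ℝ :=
  if 0 ≤ t then 1 - ∑ j ∈ Finset.range k, poissonWeight t j else 0

theorem poissonWeight_sum (t : ℝ) (k : ℕ) : ∑ j ∈ Finset.range k, poissonWeight t j =
    Real.exp (-t) * ∑ j ∈ Finset.range k, t ^ j / (j.factorial : ℝ) := by
  rw [Finset.mul_sum]
  exact Finset.sum_congr rfl fun j _ => by rw [poissonWeight]; ring

theorem jumpCdf_nonneg (k : ℕ) (t : ℝ) : 0 ≤ jumpCdf k t := by
  unfold jumpCdf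
  split_ifs with h
  · rw [sub_nonneg]
    exact sum_le_hasSum _ (fun j _ => poissonWeight_nonneg h j) (hasSum_poissonWeight t)
  · exact le_rfl

theorem hasDerivAt_sum_pow_div_factorial (k : ℕ) (v : ℝ) :
    HasDerivAt (fun v : ℝ => ∑ j ∈ Finset.range (k + 1), v ^ j / (j.factorial : ℝ))
      (∑ j ∈ Finset.range k, v ^ j / (j.factorial : ℝ)) v := by
  induction k with
  | zero => simpa using hasDerivAt_const v (1 : ℝ)
  | succ k ih =>
    have h := ih.add ((hasDerivAt_pow (k + 1) v).div_const ((k + 1).factorial : ℝ))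
    rw [Finset.sum_range_succ (n := k)]
    have e : (fun v : ℝ => ∑ j ∈ Finset.range (k + 1 + 1), v ^ j / (j.factorial : ℝ)) =
        (fun v : ℝ => ∑ j ∈ Finset.range (k + 1), v ^ j / (j.factorial : ℝ)) +
        fun v => v ^ (k + 1) / ((k + 1).factorial : ℝ) := by
      funext v
      rw [Finset.sum_range_succ]; rfl
    rw [e]
    refine h.congr_deriv ?_
    congr 1
    rw [Nat.factorial_succ]
    push_cast
    have : (k.factorial : ℝ) ≠ 0 := by positivity
    have : (k : ℝ) + 1 ≠ 0 := by positivity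
    field_simp

/-- Adding one independent exponential time turns one Erlang distribution function into the next. -/
theorem lintegral_jumpCdf (k : ℕ) (t : ℝ) :
    ∫⁻ u, ENNReal.ofReal (jumpCdf k (t - u)) ∂(expMeasure 1) =
      ENNReal.ofReal (jumpCdf (k + 1) t) := by
  have hm : Measurable fun u => jumpCdf k (t - u) := by
    unfold jumpCdf poissonWeight
    refine Measurable.ite (measurableSet_le measurable_const (by fun_prop)) ?_ measurable_const
    fun_prop
  have h1 : ∫⁻ u, ENNReal.ofReal (jumpCdf k (t - u)) ∂(expMeasure 1) =
      ∫⁻ u, (exponentialPDF 1 * fun u => ENNReal.ofReal (jumpCdf k (t - u))) u :=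
    lintegral_withDensity_eq_lintegral_mul _ (measurable_exponentialPDFReal 1).ennreal_ofReal
      hm.ennreal_ofReal
  let S : ℕ → ℝ → ℝ := fun k v => ∑ j ∈ Finset.range k, v ^ j / (j.factorial : ℝ)
  let G : ℝ → ℝ := fun u => Real.exp (-u) * (1 - Real.exp (-(t - u)) * S k (t - u))
  have h2 : ∀ u, (exponentialPDF 1 * fun u => ENNReal.ofReal (jumpCdf k (t - u))) u =
      (Set.Icc 0 t).indicator (fun u => ENNReal.ofReal (G u)) u := by
    intro u
    rw [Pi.mul_apply, exponentialPDF_eq]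
    by_cases hu : u ∈ Set.Icc 0 t
    · rw [Set.indicator_of_mem hu, if_pos hu.1, jumpCdf, if_pos (sub_nonneg.2 hu.2),
        poissonWeight_sum, ← ENNReal.ofReal_mul (by positivity)]
      simp [G, S]
    · rw [Set.indicator_of_notMem hu]
      by_cases h0 : 0 ≤ u
      · have : ¬ 0 ≤ t - u := fun h => hu ⟨h0, sub_nonneg.1 h⟩
        rw [jumpCdf, if_neg this, ENNReal.ofReal_zero, mul_zero]
      · rw [if_neg h0, ENNReal.ofReal_zero, zero_mul]
  rw [h1, lintegral_congr h2, lintegral_indicator measurableSet_Icc]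
  by_cases ht : 0 ≤ t
  · have hG0 : ∀ u ∈ Set.Icc 0 t, 0 ≤ G u := by
      intro u hu
      have := jumpCdf_nonneg k (t - u)
      rw [jumpCdf, if_pos (sub_nonneg.2 hu.2), poissonWeight_sum] at this
      exact mul_nonneg (Real.exp_pos _).le this
    have hGc : Continuous G := by
      simp only [G, S]
      fun_prop
    rw [← ofReal_integral_eq_lintegral_ofReal hGc.continuousOn.integrableOn_Icc
      ((ae_restrict_iff' measurableSet_Icc).2 (Filter.Eventually.of_forall hG0)),
      integral_Icc_eq_integral_Ioc, ← intervalIntegral.integral_of_le ht]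
    congr 1
    -- The integrand is `e^{-u} - e^{-t} S_k(t-u)`, and the derivative of the exponential partial
    -- sum `S_{k+1}` is `S_k`.
    let H : ℝ → ℝ := fun u => -Real.exp (-t) * (Real.exp (t - u) - S (k + 1) (t - u))
    have hH : ∀ u ∈ Set.uIcc 0 t, HasDerivAt H (G u) u := by
      intro u _
      have hs : HasDerivAt (fun u : ℝ => t - u) (-1) u := by
        simpa using (hasDerivAt_id u).const_sub t
      have hS : HasDerivAt (fun u => S (k + 1) (t - u)) (S k (t - u) * -1) u :=
        (hasDerivAt_sum_pow_div_factorial k (t - u)).comp u hs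
      have := (hs.exp.sub hS).const_mul (-Real.exp (-t))
      refine this.congr_deriv ?_
      simp only [G]
      have e1 : Real.exp (-u) = Real.exp (-t) * Real.exp (t - u) := by
        rw [← Real.exp_add]; ring_nf
      have e2 : Real.exp (-u) * Real.exp (-(t - u)) = Real.exp (-t) := by
        rw [← Real.exp_add]; ring_nf
      rw [mul_sub (Real.exp (-u)), mul_one, ← mul_assoc (Real.exp (-u)), e2, e1]
      ring
    rw [intervalIntegral.integral_eq_sub_of_hasDerivAt hH (hGc.intervalIntegrable _ _),
      jumpCdf, if_pos ht, poissonWeight_sum]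
    have hS0 : S (k + 1) 0 = 1 := by
      simp only [S]
      rw [Finset.sum_range_succ']
      simp
    simp only [H, sub_self, hS0, Real.exp_zero, mul_zero, sub_zero, S]
    have : Real.exp (-t) * Real.exp t = 1 := by rw [← Real.exp_add]; simp
    linear_combination this
  · rw [Set.Icc_eq_empty ht, jumpCdf, if_neg ht]
    simp

theorem holdingLaw_jumpTime_le (k : ℕ) (t : ℝ) :
    holdingLaw {τ | jumpTime τ k ≤ t} = ENNReal.ofReal (jumpCdf k t) := by
  induction k generalizing t with
  | zero =>
    by_cases ht : 0 ≤ t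
    · simp [jumpTime, jumpCdf, ht]
    · simp [jumpTime, jumpCdf, ht]
  | succ k ih =>
    have hind : IndepFun (fun τ : ℕ → ℝ => jumpTime τ k) (fun τ => τ k) holdingLaw := by
      have h := (iIndepFun_infinitePi (P := fun _ : ℕ => expMeasure 1) (X := fun _ ω => ω)
        (fun _ => measurable_id)).indepFun_finsetSum_of_notMem
        (fun i => measurable_pi_apply i) (s := Finset.range k) (i := k) (by simp)
      have e : (fun τ : ℕ → ℝ => jumpTime τ k) = ∑ j ∈ Finset.range k, fun τ : ℕ → ℝ => τ j := by
        funext τ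
        simp [jumpTime]
      rw [e]
      exact h
    have hk : holdingLaw.map (fun τ => τ k) = expMeasure 1 :=
      Measure.infinitePi_map_eval (μ := fun _ : ℕ => expMeasure 1) k
    have hprod := (indepFun_iff_map_prod_eq_prod_map_map (measurable_jumpTime k).aemeasurable
      (measurable_pi_apply k).aemeasurable).1 hind
    rw [hk] at hprod
    have hset : MeasurableSet {p : ℝ × ℝ | p.1 + p.2 ≤ t} :=
      measurableSet_le (measurable_fst.add measurable_snd) measurable_const
    have : IsProbabilityMeasure (holdingLaw.map fun τ => jumpTime τ k) :=
      Measure.isProbabilityMeasure_map (measurable_jumpTime k).aemeasurable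
    calc holdingLaw {τ | jumpTime τ (k + 1) ≤ t}
        = holdingLaw.map (fun τ => (jumpTime τ k, τ k)) {p : ℝ × ℝ | p.1 + p.2 ≤ t} := by
          rw [Measure.map_apply ((measurable_jumpTime k).prodMk (measurable_pi_apply k)) hset]
          simp only [jumpTime_succ]
          rfl
      _ = ∫⁻ u, holdingLaw {τ | jumpTime τ k ≤ t - u} ∂(expMeasure 1) := by
          rw [hprod, Measure.prod_apply_symm hset]
          refine lintegral_congr fun u => ?_
          rw [Measure.map_apply (measurable_jumpTime k)
            (measurable_prodMk_right hset)]
          congr 1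
          ext τ
          simp [le_sub_iff_add_le]
      _ = _ := by
          simp only [ih]
          exact lintegral_jumpCdf k t

/-! ### Regular holding times and the law of the number of jumps -/

/-- Holding times that are positive and have an infinite sum -/
def RegularHolding (τ : ℕ → ℝ) : Prop := (∀ i, 0 < τ i) ∧ ∀ n : ℕ, ∃ k, (n : ℝ) < jumpTime τ k

theorem measurableSet_regularHolding : MeasurableSet {τ | RegularHolding τ} := by
  have : {τ | RegularHolding τ} = (⋂ i, {τ : ℕ → ℝ | 0 < τ i}) ∩
      ⋂ n : ℕ, ⋃ k, {τ | (n : ℝ) < jumpTime τ k} := by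
    ext τ; simp [RegularHolding]
  rw [this]
  exact (MeasurableSet.iInter fun i => measurableSet_lt measurable_const
    (measurable_pi_apply i)).inter (MeasurableSet.iInter fun n => MeasurableSet.iUnion fun k =>
      measurableSet_lt measurable_const (measurable_jumpTime k))

theorem ae_regularHolding : ∀ᵐ τ ∂holdingLaw, RegularHolding τ := by
  refine Filter.Eventually.and (ae_all_iff.2 fun i => ?_) (ae_all_iff.2 fun n => ?_)
  · have hk : holdingLaw.map (fun τ => τ i) = expMeasure 1 :=
      Measure.infinitePi_map_eval (μ := fun _ : ℕ => expMeasure 1) i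
    have h0 : ∀ᵐ u ∂(expMeasure 1), 0 < u := by
      rw [ae_iff]
      have h1 := cdf_expMeasure_eq one_pos 0
      rw [cdf_eq_real] at h1
      simp only [le_refl, if_true, mul_zero, neg_zero, Real.exp_zero, sub_self] at h1
      have h2 := (measureReal_eq_zero_iff).1 h1
      simpa [Set.Iic] using h2
    rw [← hk] at h0
    exact ae_of_ae_map (measurable_pi_apply i).aemeasurable h0
  · rw [ae_iff]
    simp only [not_exists, not_lt]
    -- Explosion before time `n` has probability at most every Poisson tail `P(N ≥ k)`, and these
    -- tend to zero.
    have hle : ∀ k, holdingLaw {τ | ∀ k, jumpTime τ k ≤ n} ≤ ENNReal.ofReal (jumpCdf k n) :=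
      fun k => by
        rw [← holdingLaw_jumpTime_le]
        exact measure_mono fun τ h => h k
    have hlim : Filter.Tendsto (fun k => ENNReal.ofReal (jumpCdf k n)) Filter.atTop (nhds 0) := by
      have h1 := (hasSum_poissonWeight (n : ℝ)).tendsto_sum_nat.const_sub 1
      rw [sub_self] at h1
      have h2 : (fun k => jumpCdf k n) =
          fun k => 1 - ∑ j ∈ Finset.range k, poissonWeight (n : ℝ) j := by
        funext k
        rw [jumpCdf, if_pos n.cast_nonneg]
      rw [← ENNReal.ofReal_zero]
      exact ENNReal.tendsto_ofReal (h2 ▸ h1)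
    exact le_antisymm (ge_of_tendsto' hlim hle) zero_le

theorem RegularHolding.strictMono {τ : ℕ → ℝ} (h : RegularHolding τ) :
    StrictMono (jumpTime τ) :=
  strictMono_nat_of_lt_succ fun k => by
    rw [jumpTime_succ]; linarith [h.1 k]

theorem RegularHolding.jumpCount_spec {τ : ℕ → ℝ} (h : RegularHolding τ) (t : ℝ≥0) :
    jumpTime τ (jumpCount τ t) ≤ t ∧ (t : ℝ) < jumpTime τ (jumpCount τ t + 1) := by
  obtain ⟨n, hn⟩ := exists_nat_ge (t : ℝ)
  obtain ⟨k, hk⟩ := h.2 n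
  -- Boundedness matters: the supremum of an unbounded set of natural numbers is `0` by default.
  have hbdd : BddAbove {n : ℕ | ∑ i ∈ Finset.range n, τ i ≤ t} :=
    ⟨k, fun m hm => (h.strictMono.lt_iff_lt.1 ((show jumpTime τ m ≤ t from hm).trans_lt
      (hn.trans_lt hk))).le⟩
  refine ⟨Nat.sSup_mem ⟨0, by simp⟩ hbdd, ?_⟩
  by_contra! hc
  exact absurd (le_csSup hbdd (show jumpCount τ t + 1 ∈ _ from hc)) (by
    rw [← jumpCount]; exact Nat.not_succ_le_self _)

theorem RegularHolding.jumpCount_eq_iff {τ : ℕ → ℝ} (h : RegularHolding τ) (t : ℝ≥0) (k : ℕ) :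
    jumpCount τ t = k ↔ jumpTime τ k ≤ t ∧ (t : ℝ) < jumpTime τ (k + 1) := by
  constructor
  · rintro rfl
    exact h.jumpCount_spec t
  · rintro ⟨h1, h2⟩
    obtain ⟨h3, h4⟩ := h.jumpCount_spec t
    have h5 := h.strictMono.lt_iff_lt.1 (h3.trans_lt h2)
    have h6 := h.strictMono.lt_iff_lt.1 (h1.trans_lt h4)
    omega

theorem holdingLaw_jumpCount (t : ℝ≥0) (k : ℕ) :
    holdingLaw {τ | RegularHolding τ ∧ jumpTime τ k ≤ t ∧ (t : ℝ) < jumpTime τ (k + 1)} =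
      ENNReal.ofReal (poissonWeight t k) := by
  have h1 : holdingLaw {τ | RegularHolding τ ∧ jumpTime τ k ≤ t ∧ (t : ℝ) < jumpTime τ (k + 1)} =
      holdingLaw ({τ | jumpTime τ k ≤ t} \ {τ | jumpTime τ (k + 1) ≤ t}) := by
    refine measure_congr ?_
    filter_upwards [ae_regularHolding] with τ hτ
    refine propext ⟨fun h => ⟨h.2.1, not_le.2 h.2.2⟩, fun h => ⟨hτ, h.1, not_le.1 h.2⟩⟩
  have h2 : ({τ | jumpTime τ (k + 1) ≤ t} : Set (ℕ → ℝ)) ≤ᵐ[holdingLaw] {τ | jumpTime τ k ≤ t} := by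
    filter_upwards [ae_regularHolding] with τ hτ h
    exact (hτ.strictMono (Nat.lt_succ_self k)).le.trans h
  rw [h1, measure_sdiff' _ (measurableSet_le (measurable_jumpTime _)
      measurable_const).nullMeasurableSet (measure_ne_top _ _),
    measure_congr (union_ae_eq_left_iff_ae_subset.2 h2), holdingLaw_jumpTime_le,
    holdingLaw_jumpTime_le, ← ENNReal.ofReal_sub _ (jumpCdf_nonneg _ _), jumpCdf, jumpCdf,
    if_pos t.coe_nonneg, if_pos t.coe_nonneg, Finset.sum_range_succ]
  congr 1
  ring

end FiniteChain

namespace FiniteChain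

/-! ### The hitting probabilities of the continuous-time chain -/

/-- The path is constant between jumps and holds its new state from the jump time on, so the states
seen up to time `t` are exactly the first `jumpCount τ t + 1` states of the discrete chain. -/
theorem RegularHolding.lt_hittingAfter_iff {Ω : Type*} {τ : ℕ → ℝ} (h : RegularHolding τ)
    (ω : ℕ → Ω) (A : Set Ω) (t : ℝ≥0) :
    (t : WithTop ℝ≥0) < hittingAfter processCt A 0 (ω, τ) ↔ ∀ j ≤ jumpCount τ t, ω j ∉ A := by
  have hnn : ∀ k, 0 ≤ jumpTime τ k := fun k => Finset.sum_nonneg fun i _ => (h.1 i).le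
  obtain ⟨h1, h2⟩ := h.jumpCount_spec t
  constructor
  · intro hlt j hj hjA
    refine absurd hlt (not_lt.2 ?_)
    let s : ℝ≥0 := ⟨jumpTime τ j, hnn j⟩
    have hjc : jumpCount τ s = j :=
      (h.jumpCount_eq_iff s j).2 ⟨le_rfl, h.strictMono (Nat.lt_succ_self j)⟩
    have hmem : processCt s (ω, τ) ∈ A := by
      change ω (jumpCount τ s) ∈ A
      rwa [hjc]
    refine (hittingAfter_le_of_mem zero_le hmem).trans (WithTop.coe_le_coe.2 ?_)
    exact NNReal.coe_le_coe.1 ((h.strictMono.monotone hj).trans h1)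
  · intro hA
    -- The next jump time lies strictly after `t` and no new state appears before it; this gives the
    -- strict inequality for the infimum.
    let s' : ℝ≥0 := ⟨jumpTime τ (jumpCount τ t + 1), hnn _⟩
    have hlt : t < s' := NNReal.coe_lt_coe.1 h2
    refine (WithTop.coe_lt_coe.2 hlt).trans_le (not_lt.1 fun hc => ?_)
    obtain ⟨s, hs, hsA⟩ := hittingAfter_lt_iff.1 hc
    refine hA _ ?_ hsA
    have h3 := (h.jumpCount_spec s).1
    have h4 : (s : ℝ) < jumpTime τ (jumpCount τ t + 1) := NNReal.coe_lt_coe.2 hs.2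
    exact Nat.lt_succ_iff.1 (h.strictMono.lt_iff_lt.1 (h3.trans_lt h4))

section HittingCt

variable {Ω : Type*} [Fintype Ω] [DecidableEq Ω] [MeasurableSpace Ω] [MeasurableSingletonClass Ω]

/-- Split according to the number of jumps up to `t`, which is Poisson and independent of the
discrete chain. -/
theorem chainLawCt_lt_hittingAfter (P : Matrix.rowStochastic ℝ Ω) (x : Ω) (A : Finset Ω)
    (t : ℝ≥0) :
    (chainLawCt P x).real {ω | (t : WithTop ℝ≥0) < hittingAfter processCt (A : Set Ω) 0 ω} =
      killedTailCt P t A x := by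
  let D : ℕ → Set (ℕ → Ω) := fun k => {ω | ∀ j ≤ k, ω j ∉ A}
  let R : ℕ → Set (ℕ → ℝ) := fun k =>
    {τ | RegularHolding τ ∧ jumpTime τ k ≤ t ∧ (t : ℝ) < jumpTime τ (k + 1)}
  have hR : ∀ k, MeasurableSet (R k) := fun k =>
    measurableSet_regularHolding.inter ((measurableSet_le (measurable_jumpTime k)
      measurable_const).inter (measurableSet_lt measurable_const (measurable_jumpTime (k + 1))))
  have hreg : ∀ᵐ p ∂(chainLawCt P x), RegularHolding p.2 :=
    (Measure.quasiMeasurePreserving_snd (μ := chainLaw P x) (ν := holdingLaw)).ae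
      ae_regularHolding
  have hae : {ω | (t : WithTop ℝ≥0) < hittingAfter processCt (A : Set Ω) 0 ω} =ᵐ[chainLawCt P x]
      ⋃ k, D k ×ˢ R k := by
    filter_upwards [hreg] with p hp
    refine propext ((hp.lt_hittingAfter_iff p.1 (A : Set Ω) t).trans ⟨fun h => ?_, fun h => ?_⟩)
    · exact Set.mem_iUnion.2 ⟨jumpCount p.2 t, h, hp, hp.jumpCount_spec t⟩
    · obtain ⟨k, hk1, hk2⟩ := Set.mem_iUnion.1 h
      have := (hp.jumpCount_eq_iff t k).2 hk2.2
      rw [this]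
      exact hk1
  have hdisj : Pairwise (Function.onFun Disjoint fun k => D k ×ˢ R k) := by
    intro i j hij
    refine Set.disjoint_left.2 fun p hi hj => hij ?_
    rw [← (hi.2.1.jumpCount_eq_iff t i).2 hi.2.2, (hj.2.1.jumpCount_eq_iff t j).2 hj.2.2]
  have hk : ∀ k, chainLawCt P x (D k ×ˢ R k) =
      ENNReal.ofReal (poissonWeight t k * killedTail P k A x) := by
    intro k
    change ((chainLaw P x).prod holdingLaw) (D k ×ˢ R k) = _
    rw [Measure.prod_prod, chainLaw_avoid, holdingLaw_jumpCount, mul_comm,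
      ← ENNReal.ofReal_mul (poissonWeight_nonneg t.coe_nonneg k)]
  have hnn : ∀ k, 0 ≤ poissonWeight t k * killedTail P k A x := fun k =>
    mul_nonneg (poissonWeight_nonneg t.coe_nonneg k) (killedTail_nonneg P k A x)
  have hsum : Summable fun k => poissonWeight t k * killedTail P k A x :=
    (hasSum_poissonWeight t).summable.of_nonneg_of_le hnn fun k =>
      mul_le_of_le_one_right (poissonWeight_nonneg t.coe_nonneg k) (killedTail_le_one P k A x)
  rw [measureReal_def, measure_congr hae, measure_iUnion hdisj fun k =>
    (measurableSet_avoid A k).prod (hR k)]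
  simp only [hk]
  rw [← ENNReal.ofReal_tsum_of_nonneg hnn hsum, ENNReal.toReal_ofReal (tsum_nonneg hnn)]
  rfl

end HittingCt

/-! ### Mixing times and hitting times -/

section Times

variable {Ω : Type*} [Fintype Ω] [DecidableEq Ω]

theorem ciSup_le_iff_of_finite {ι : Type*} [Finite ι] [Nonempty ι] {f : ι → ℝ} {a : ℝ} :
    ⨆ i, f i ≤ a ↔ ∀ i, f i ≤ a :=
  ciSup_le_iff (Set.finite_range f).bddAbove

theorem dist_le_iff [Nonempty Ω] (P : Matrix.rowStochastic ℝ Ω) (π : Ω → ℝ) (t : ℕ) (δ : ℝ) :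
    dist P π t ≤ δ ↔ MixLe π (fun n => P.1 ^ n) t δ :=
  ciSup_le_iff_of_finite

theorem distCt_le_iff [Nonempty Ω] (P : Matrix.rowStochastic ℝ Ω) (π : Ω → ℝ) (t : ℝ≥0) (δ : ℝ) :
    distCt P π t ≤ δ ↔ MixLe π (heatMatrix P) t δ :=
  ciSup_le_iff_of_finite

/-- Truncated subtraction avoids any need for the infimum to be attained, so the same argument
serves `ℕ` and `ℝ≥0`. -/
theorem sInf_le_sInf_add {α : Type*} [ConditionallyCompleteLinearOrderBot α] [Add α] [Sub α]
    [OrderedSub α] {S U : Set α} {s : α} (hS : S.Nonempty) (h : ∀ t ∈ S, t + s ∈ U) :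
    sInf U ≤ sInf S + s :=
  tsub_le_iff_right.1 (le_csInf hS fun t ht => tsub_le_iff_right.2 (csInf_le' (h t ht)))

theorem iSup_iSup_le_iff {Ω : Type*} [Fintype Ω] [Nonempty Ω] {π : Ω → ℝ} (hπ : ∑ x, π x = 1) {α : ℝ} (hα : α ≤ 1)
    (F : Ω → Finset Ω → ℝ) {p : ℝ} :
    (⨆ x, ⨆ A : {A : Finset Ω // α ≤ ∑ y ∈ A, π y}, F x A.1) ≤ p ↔
      ∀ x A, α ≤ ∑ y ∈ A, π y → F x A ≤ p := by
  -- The whole space is admissible because `α ≤ 1`; a real supremum over an empty index type would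
  -- be `0` by default.
  have : Nonempty {A : Finset Ω // α ≤ ∑ y ∈ A, π y} := ⟨⟨Finset.univ, by rwa [hπ]⟩⟩
  simp only [ciSup_le_iff_of_finite, Subtype.forall]

variable [MeasurableSpace Ω] [MeasurableSingletonClass Ω]

theorem hitTail_le_iff [Nonempty Ω] (P : Matrix.rowStochastic ℝ Ω) {π : Ω → ℝ}
    (hπ : ∑ x, π x = 1) {α : ℝ} (hα : α ≤ 1) (t : ℕ) (p : ℝ) :
    hitTail P π α t ≤ p ↔ HitLe π (fun n A => killedTail P n A) t α p := by
  simp only [hitTail, chainLaw_lt_hittingAfter]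
  exact iSup_iSup_le_iff hπ hα fun x A => killedTail P t A x

theorem hitTailCt_le_iff [Nonempty Ω] (P : Matrix.rowStochastic ℝ Ω) {π : Ω → ℝ}
    (hπ : ∑ x, π x = 1) {α : ℝ} (hα : α ≤ 1) (t : ℝ≥0) (p : ℝ) :
    hitTailCt P π α t ≤ p ↔ HitLe π (fun t A => killedTailCt P t A) t α p := by
  simp only [hitTailCt, chainLawCt_lt_hittingAfter]
  exact iSup_iSup_le_iff hπ hα fun x A => killedTailCt P t A x

end Times

/-! ### The lower bound by the relaxation time -/

section RelaxationTime

variable {Ω : Type*} [Fintype Ω] [DecidableEq Ω] {P : Matrix.rowStochastic ℝ Ω} {π : Ω → ℝ}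

theorem ip_one_eq_zero_of_eigenvalue (hrev : IsReversible P π) {f : Ω → ℝ} {l : ℝ}
    (h : P.1.mulVec f = l • f) (hl : l ≠ 1) : ip π f 1 = 0 := by
  have h1 := ip_mulVec_comm hrev f 1
  rw [h, mulVec_const_one, ip_smul_left] at h1
  have h2 : (l - 1) * ip π f 1 = 0 := by linarith
  exact (mul_eq_zero.1 h2).resolve_left (sub_ne_zero.2 hl)

/-- An eigenfunction for `λ = λ₂` gives `λ^t ≤ 2δ`. The loss from `relTime` to `relTime - 1 =
λ/(1-λ)` comes from `-log λ ≤ 1/λ - 1`. -/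
theorem relTime_sub_one_mul_le_of_mixLe (hl : IsLazy P) (hstat : IsStationary P π)
    (hirr : P.1.IsIrreducible) (hrev : IsReversible P π) {t : ℕ} {δ : ℝ} (hδ0 : 0 < δ)
    (hδ : δ ≤ 1 / 4) (ht : MixLe π (fun n => P.1 ^ n) t δ) :
    (relTime P - 1) * |Real.log (2 * δ)| ≤ t := by
  rcases secondEigenvalue_eq_zero_or P with h | ⟨h1, f, hf, h⟩
  -- If `λ₂ = 0`, also as a default value, the relaxation time is `1` and the left side vanishes.
  · simp [relTime, h]
  obtain ⟨E⟩ := exists_eigenBasis (hstat.pos hirr) hrev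
  rcases (hl.eigenvalue_nonneg hf h).eq_or_lt with h0 | h0
  · simp [relTime, ← h0]
  set l := secondEigenvalue P with hldef
  have hl1 : 0 < 1 - l := gap_pos P
  have h2 := abs_le_two_mul_of_mixLe (l := l ^ t) ht hf (ip_one_eq_zero_of_eigenvalue hrev h h1)
    (by rw [← E.fn_pow, E.fn_eq_of_mulVec h])
  rw [abs_of_pos (pow_pos h0 t)] at h2
  have h3 := Real.log_le_log (pow_pos h0 t) h2
  rw [Real.log_pow] at h3
  have h4 : Real.log (2 * δ) ≤ 0 := Real.log_nonpos (by linarith) (by linarith)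
  have h5 : -Real.log l ≤ l⁻¹ - 1 := by
    rw [← Real.log_inv]
    exact Real.log_le_sub_one_of_pos (inv_pos.2 h0)
  rw [abs_of_nonpos h4]
  have h6 : -Real.log (2 * δ) ≤ t * (l⁻¹ - 1) := by
    have := mul_le_mul_of_nonneg_left h5 (Nat.cast_nonneg (α := ℝ) t)
    linarith
  have h7 : relTime P - 1 = l / (1 - l) := by
    rw [relTime, ← hldef]
    field_simp
    ring
  rw [h7]
  calc l / (1 - l) * -Real.log (2 * δ) ≤ l / (1 - l) * (t * (l⁻¹ - 1)) :=
        mul_le_mul_of_nonneg_left h6 (div_pos h0 hl1).le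
    _ = t := by field_simp

/-- Here the eigenfunction gives `e^{-t(1-λ₂)} ≤ 2δ`, hence the stronger bound with `relTime` in
place of `relTime - 1`. -/
theorem relTime_sub_one_mul_le_of_mixLeCt (hstat : IsStationary P π)
    (hirr : P.1.IsIrreducible) (hrev : IsReversible P π) {t : ℝ≥0} {δ : ℝ} (hδ0 : 0 < δ)
    (hδ : δ ≤ 1 / 4) (ht : MixLe π (heatMatrix P) t δ) :
    (relTime P - 1) * |Real.log (2 * δ)| ≤ t := by
  rcases secondEigenvalue_eq_zero_or P with h | ⟨h1, f, hf, h⟩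
  · simp [relTime, h]
  obtain ⟨E⟩ := exists_eigenBasis (hstat.pos hirr) hrev
  set l := secondEigenvalue P with hldef
  have hl1 : 0 < 1 - l := gap_pos P
  have h2 := abs_le_two_mul_of_mixLe ht hf (ip_one_eq_zero_of_eigenvalue hrev h h1)
    (by rw [heatMatrix_mulVec E, E.fn_eq_of_mulVec h])
  rw [abs_of_pos (heatMul_pos _ _), heatMul, ← Real.le_log_iff_exp_le (by linarith)] at h2
  have h4 : Real.log (2 * δ) ≤ 0 := Real.log_nonpos (by linarith) (by linarith)
  rw [abs_of_nonpos h4]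
  have h5 : relTime P * -Real.log (2 * δ) ≤ t := by
    rw [relTime, ← hldef, inv_mul_le_iff₀ hl1]
    linarith
  linarith

end RelaxationTime

end FiniteChain

namespace FiniteChain

/-! ### The six comparisons of mixing and hitting times -/

section Comparison

variable {Ω : Type*} [Fintype Ω] [DecidableEq Ω]
  {P : Matrix.rowStochastic ℝ Ω} {π : Ω → ℝ}

theorem IsStationary.nonempty (hstat : IsStationary P π) : Nonempty Ω := by
  by_contra h
  rw [not_nonempty_iff] at h
  have : ∑ x, π x = 1 := hstat.1.2
  simp at this

theorem le_gap_mul_of_relTime_mul_le {a s : ℝ} (h : relTime P * a ≤ s) : a ≤ gap P * s := by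
  rw [relTime_eq_inv_gap, inv_mul_le_iff₀ (gap_pos P)] at h
  exact h

theorem relTime_pos (P : Matrix.rowStochastic ℝ Ω) : 0 < relTime P := inv_pos.2 (gap_pos P)

theorem coe_toNat_ceil {a : ℝ} (ha : 0 ≤ a) : ((⌈a⌉.toNat : ℕ) : ℝ) = (⌈a⌉ : ℤ) := by
  have : ((⌈a⌉.toNat : ℕ) : ℤ) = ⌈a⌉ := Int.toNat_of_nonneg (Int.ceil_nonneg ha)
  exact_mod_cast this

theorem le_toNat_ceil {a : ℝ} (ha : 0 ≤ a) : a ≤ (⌈a⌉.toNat : ℕ) := by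
  rw [coe_toNat_ceil ha]
  exact Int.le_ceil a

theorem sInf_hit_le_add {S U : Set ℕ} {a : ℝ} (ha : 0 ≤ a) (hS : S.Nonempty)
    (h : ∀ t ∈ S, t + ⌈a⌉.toNat ∈ U) : ((sInf U : ℕ) : ℝ) ≤ ((sInf S : ℕ) : ℝ) + (⌈a⌉ : ℤ) := by
  rw [← coe_toNat_ceil ha]
  exact_mod_cast sInf_le_sInf_add hS h

theorem sInf_hitCt_le_add {S U : Set ℝ≥0} {a : ℝ} (ha : 0 ≤ a) (hS : S.Nonempty)
    (h : ∀ t ∈ S, t + a.toNNReal ∈ U) : ((sInf U : ℝ≥0) : ℝ) ≤ ((sInf S : ℝ≥0) : ℝ) + a := by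
  have := NNReal.coe_le_coe.2 (sInf_le_sInf_add hS h)
  rwa [NNReal.coe_add, Real.coe_toNNReal a ha] at this

end Comparison

end FiniteChain

end

/-! ### The theorem in discrete and continuous time -/

open FiniteChain
theorem mainTheorem3 {Ω : Type*} [Fintype Ω] [DecidableEq Ω]
    [MeasurableSpace Ω] [MeasurableSingletonClass Ω]
    (P : Matrix.rowStochastic ℝ Ω) (π : Ω → ℝ)
    (hstat : FiniteChain.IsStationary P π)
    (hirr : P.1.IsIrreducible)
    (hrev : FiniteChain.IsReversible P π)
    (ε : ℝ) (hε0 : 0 < ε) (hε : ε ≤ 1 / 4) :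
    -- discrete time, lazy chain
    (FiniteChain.IsLazy P →
      ((FiniteChain.hit P π (1 / 2) (3 * ε / 2) : ℝ)
            - (⌈2 * FiniteChain.relTime P * |Real.log ε|⌉ : ℤ)
          ≤ (FiniteChain.tMix P π ε : ℝ) ∧
        (FiniteChain.tMix P π ε : ℝ)
          ≤ (FiniteChain.hit P π (1 / 2) (ε / 2) : ℝ)
            + (⌈FiniteChain.relTime P * Real.log (4 / ε)⌉ : ℤ)) ∧
      ((FiniteChain.hit P π (1 / 2) (1 - ε / 2) : ℝ)
            - (⌈2 * FiniteChain.relTime P * |Real.log ε|⌉ : ℤ)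
          ≤ (FiniteChain.tMix P π (1 - ε) : ℝ) ∧
        (FiniteChain.tMix P π (1 - ε) : ℝ)
          ≤ (FiniteChain.hit P π (1 / 2) (1 - 2 * ε) : ℝ)
            + (⌈FiniteChain.relTime P⌉ : ℤ)) ∧
      (max (FiniteChain.hit P π (1 - ε / 4) (5 * ε / 4) : ℝ)
            ((FiniteChain.relTime P - 1) * |Real.log (2 * ε)|)
          ≤ (FiniteChain.tMix P π ε : ℝ) ∧
        (FiniteChain.tMix P π ε : ℝ)
          ≤ (FiniteChain.hit P π (1 - ε / 4) (3 * ε / 4) : ℝ)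
            + (⌈3 * FiniteChain.relTime P / 2 * Real.log (4 / ε)⌉ : ℤ))) ∧
    -- continuous time, no ceilings; laziness is not needed
    (((FiniteChain.hitCt P π (1 / 2) (3 * ε / 2) : ℝ)
            - 2 * FiniteChain.relTime P * |Real.log ε|
          ≤ (FiniteChain.tMixCt P π ε : ℝ) ∧
        (FiniteChain.tMixCt P π ε : ℝ)
          ≤ (FiniteChain.hitCt P π (1 / 2) (ε / 2) : ℝ)
            + FiniteChain.relTime P * Real.log (4 / ε)) ∧
      ((FiniteChain.hitCt P π (1 / 2) (1 - ε / 2) : ℝ)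
            - 2 * FiniteChain.relTime P * |Real.log ε|
          ≤ (FiniteChain.tMixCt P π (1 - ε) : ℝ) ∧
        (FiniteChain.tMixCt P π (1 - ε) : ℝ)
          ≤ (FiniteChain.hitCt P π (1 / 2) (1 - 2 * ε) : ℝ)
            + FiniteChain.relTime P) ∧
      (max (FiniteChain.hitCt P π (1 - ε / 4) (5 * ε / 4) : ℝ)
            ((FiniteChain.relTime P - 1) * |Real.log (2 * ε)|)
          ≤ (FiniteChain.tMixCt P π ε : ℝ) ∧
        (FiniteChain.tMixCt P π ε : ℝ)
          ≤ (FiniteChain.hitCt P π (1 - ε / 4) (3 * ε / 4) : ℝ)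
            + 3 * FiniteChain.relTime P / 2 * Real.log (4 / ε))) := by

  have : Nonempty Ω := hstat.nonempty
  have hπ : ∑ x, π x = 1 := hstat.1.2
  have hrel := relTime_pos P
  have hlog4 : 0 < Real.log (4 / ε) :=
    Real.log_pos ((one_lt_div hε0).2 (by linarith))
  have ha1 : 0 ≤ 2 * relTime P * |Real.log ε| := by positivity
  have ha2 : 0 ≤ relTime P * Real.log (4 / ε) := by positivity
  have ha3 : 0 ≤ 3 * relTime P / 2 * Real.log (4 / ε) := by positivity
  have hg1 : ∀ s, 2 * relTime P * |Real.log ε| ≤ s → 2 * |Real.log ε| ≤ gap P * s := fun s hs =>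
    le_gap_mul_of_relTime_mul_le (by linarith)
  have hg2 : ∀ s, relTime P * Real.log (4 / ε) ≤ s → Real.log (4 / ε) ≤ gap P * s := fun s hs =>
    le_gap_mul_of_relTime_mul_le hs
  have hg3 : ∀ s, 3 * relTime P / 2 * Real.log (4 / ε) ≤ s →
      3 / 2 * Real.log (4 / ε) ≤ gap P * s := fun s hs =>
    le_gap_mul_of_relTime_mul_le (by linarith)
  have hg4 : ∀ s, relTime P ≤ s → 1 ≤ gap P * s := fun s hs =>
    le_gap_mul_of_relTime_mul_le (by linarith)
  have hα : (1 / 2 : ℝ) ≤ 1 := by norm_num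
  have hα' : 1 - ε / 4 ≤ 1 := by linarith
  refine ⟨fun hl => ?_, ?_⟩
  · have H := hittingSystem_nat hl hstat hirr hrev
    have hhit : ∀ α p, 0 < α → α ≤ 1 → 0 < p → {t | hitTail P π α t ≤ p}.Nonempty :=
      fun α p h0 h1 hp => (H.exists_hitLe h0 hp).imp fun t ht =>
        (hitTail_le_iff P hπ h1 t p).2 ht
    have u1 : ∀ t ∈ {t | hitTail P π (1 / 2) t ≤ ε / 2},
        t + ⌈relTime P * Real.log (4 / ε)⌉.toNat ∈ {t | dist P π t ≤ ε} := fun t ht =>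
      (dist_le_iff P π _ _).2 (H.mixLe_of_hitLe_half hε0 hε ((hitTail_le_iff P hπ hα t _).1 ht)
        (hg2 _ (le_toNat_ceil ha2)))
    have u2 : ∀ t ∈ {t | hitTail P π (1 / 2) t ≤ 1 - 2 * ε},
        t + ⌈relTime P⌉.toNat ∈ {t | dist P π t ≤ 1 - ε} := fun t ht =>
      (dist_le_iff P π _ _).2 (H.mixLe_one_sub_of_hitLe hε0 hε ((hitTail_le_iff P hπ hα t _).1 ht)
        (hg4 _ (le_toNat_ceil hrel.le)))
    have u3 : ∀ t ∈ {t | hitTail P π (1 - ε / 4) t ≤ 3 * ε / 4},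
        t + ⌈3 * relTime P / 2 * Real.log (4 / ε)⌉.toNat ∈ {t | dist P π t ≤ ε} := fun t ht =>
      (dist_le_iff P π _ _).2 (H.mixLe_of_hitLe hε0 hε ((hitTail_le_iff P hπ hα' t _).1 ht)
        (hg3 _ (le_toNat_ceil ha3)))
    have l1 : ∀ δ p, δ + ε / 2 = p → ∀ t ∈ {t | dist P π t ≤ δ},
        t + ⌈2 * relTime P * |Real.log ε|⌉.toNat ∈ {t | hitTail P π (1 / 2) t ≤ p} :=
      fun δ p hp t ht => (hitTail_le_iff P hπ hα _ _).2 (hp ▸ H.hitLe_add_of_mixLe hε0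
        ((dist_le_iff P π t δ).1 ht) (hg1 _ (le_toNat_ceil ha1)))
    have hh1 := hhit (1 / 2) (ε / 2) (by norm_num) hα (by linarith)
    have hh2 := hhit (1 / 2) (1 - 2 * ε) (by norm_num) hα (by linarith)
    have hh3 := hhit (1 - ε / 4) (3 * ε / 4) (by linarith) hα' (by linarith)
    have hm1 : {t | dist P π t ≤ ε}.Nonempty := hh1.elim fun t ht => ⟨_, u1 t ht⟩
    have hm2 : {t | dist P π t ≤ 1 - ε}.Nonempty := hh2.elim fun t ht => ⟨_, u2 t ht⟩
    -- In discrete time the infimum is attained, so the last two lower bounds can be read off at the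
    -- mixing time itself.
    have hmem := (dist_le_iff P π _ _).1 (Nat.sInf_mem hm1)
    refine ⟨⟨sub_le_iff_le_add.2 (sInf_hit_le_add ha1 hm1 (l1 _ _ (by ring))),
      sInf_hit_le_add ha2 hh1 u1⟩, ⟨sub_le_iff_le_add.2
      (sInf_hit_le_add ha1 hm2 (l1 _ _ (by ring))), sInf_hit_le_add hrel.le hh2 u2⟩,
      max_le (Nat.cast_le.2 (Nat.sInf_le ((hitTail_le_iff P hπ hα' _ _).2
        (H.hitLe_of_mixLe hmem))))
        (relTime_sub_one_mul_le_of_mixLe hl hstat hirr hrev hε0 hε hmem),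
      sInf_hit_le_add ha3 hh3 u3⟩
  · have H := hittingSystem_nnreal hstat hirr hrev
    have hhit : ∀ α p, 0 < α → α ≤ 1 → 0 < p → {t | hitTailCt P π α t ≤ p}.Nonempty :=
      fun α p h0 h1 hp => (H.exists_hitLe h0 hp).imp fun t ht =>
        (hitTailCt_le_iff P hπ h1 t p).2 ht
    have u1 : ∀ t ∈ {t | hitTailCt P π (1 / 2) t ≤ ε / 2},
        t + (relTime P * Real.log (4 / ε)).toNNReal ∈ {t | distCt P π t ≤ ε} := fun t ht =>
      (distCt_le_iff P π _ _).2 (H.mixLe_of_hitLe_half hε0 hε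
        ((hitTailCt_le_iff P hπ hα t _).1 ht) (hg2 _ (Real.le_coe_toNNReal _)))
    have u2 : ∀ t ∈ {t | hitTailCt P π (1 / 2) t ≤ 1 - 2 * ε},
        t + (relTime P).toNNReal ∈ {t | distCt P π t ≤ 1 - ε} := fun t ht =>
      (distCt_le_iff P π _ _).2 (H.mixLe_one_sub_of_hitLe hε0 hε
        ((hitTailCt_le_iff P hπ hα t _).1 ht) (hg4 _ (Real.le_coe_toNNReal _)))
    have u3 : ∀ t ∈ {t | hitTailCt P π (1 - ε / 4) t ≤ 3 * ε / 4},
        t + (3 * relTime P / 2 * Real.log (4 / ε)).toNNReal ∈ {t | distCt P π t ≤ ε} :=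
      fun t ht => (distCt_le_iff P π _ _).2 (H.mixLe_of_hitLe hε0 hε
        ((hitTailCt_le_iff P hπ hα' t _).1 ht) (hg3 _ (Real.le_coe_toNNReal _)))
    have l1 : ∀ δ p, δ + ε / 2 = p → ∀ t ∈ {t | distCt P π t ≤ δ},
        t + (2 * relTime P * |Real.log ε|).toNNReal ∈ {t | hitTailCt P π (1 / 2) t ≤ p} :=
      fun δ p hp t ht => (hitTailCt_le_iff P hπ hα _ _).2 (hp ▸ H.hitLe_add_of_mixLe hε0
        ((distCt_le_iff P π t δ).1 ht) (hg1 _ (Real.le_coe_toNNReal _)))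
    -- A shift by zero: attainment of the infimum is not used in continuous time, so the infima of
    -- the two sets are compared instead.
    have l3 : ∀ t ∈ {t | distCt P π t ≤ ε},
        t + (0 : ℝ).toNNReal ∈ {t | hitTailCt P π (1 - ε / 4) t ≤ 5 * ε / 4} := fun t ht => by
      rw [Real.toNNReal_zero, add_zero]
      exact (hitTailCt_le_iff P hπ hα' _ _).2 (H.hitLe_of_mixLe ((distCt_le_iff P π t _).1 ht))
    have hh1 := hhit (1 / 2) (ε / 2) (by norm_num) hα (by linarith)
    have hh2 := hhit (1 / 2) (1 - 2 * ε) (by norm_num) hα (by linarith)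
    have hh3 := hhit (1 - ε / 4) (3 * ε / 4) (by linarith) hα' (by linarith)
    have hm1 : {t | distCt P π t ≤ ε}.Nonempty := hh1.elim fun t ht => ⟨_, u1 t ht⟩
    have hm2 : {t | distCt P π t ≤ 1 - ε}.Nonempty := hh2.elim fun t ht => ⟨_, u2 t ht⟩
    refine ⟨⟨sub_le_iff_le_add.2 (sInf_hitCt_le_add ha1 hm1 (l1 _ _ (by ring))),
      sInf_hitCt_le_add ha2 hh1 u1⟩, ⟨sub_le_iff_le_add.2
      (sInf_hitCt_le_add ha1 hm2 (l1 _ _ (by ring))), sInf_hitCt_le_add hrel.le hh2 u2⟩,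
      max_le ((sInf_hitCt_le_add le_rfl hm1 l3).trans_eq (add_zero _)) ?_,
      sInf_hitCt_le_add ha3 hh3 u3⟩
    exact Real.toNNReal_le_iff_le_coe.1 (le_csInf hm1 fun t ht =>
      Real.toNNReal_le_iff_le_coe.2 (relTime_sub_one_mul_le_of_mixLeCt hstat hirr hrev hε0 hε
        ((distCt_le_iff P π t _).1 ht)))
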